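/- Fix an integer $m\ge 1$. For each integer $n\ge 1$, coupons are drawn one at a time, independently and uniformly from $n$ types. Let $T=T(n)$ be the number of coupons drawn until every type has been seen at least $m$ times, and let $S_k=S_k(n)$ be the number of types seen exactly $k$ times by time $T$. For $n\ge 2$ put $$c_m(n)=e\log n+\Bigl((e-1)(m-1)-\tfrac12\Bigr)\log\log n .$$ 1) Let $d\in\mathbb{R}$, let $(n_j)_j$ be a strictly increasing sequence of positive integers, and let $(d_j)_j$ be a sequence of real numbers with $d_j\to d$ such that $k_j=c_m(n_j)+d_j$ is a non-negative integer for every $j$ with $n_j\ge 2$. Then, as $j\to\infty$, the pair $$\left(\frac{T-n_j\log n_j-(m-1)n_j\log\log n_j}{n_j},\;S_{k_j}\right)\qquad(\text{with } n=n_j)$$ converges in distribution to a pair $(X,Y)$, where $X$ has the Gumbel distribution function $P(X\le x)=\exp\bigl(-e^{-x}/(m-1)!\bigr)$, i.e. $X\sim\mathrm{Gumbel}(-\log((m-1)!),1)$, and, conditionally on $X$, $Y$ is Poisson distributed with mean $e^{(e-1)X-d}/\sqrt{2\pi e}$. 2) Let $g$ be a real-valued function on the positive integers with $g(n)\to\infty$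 and $g(n)=o(\log\log n)$ such that $k=k(n)=c_m(n)+g(n)$ is a non-negative integer for every $n\ge 2$. Then $S_{k(n)}\to 0$ in probability as $n\to\infty$, i.e. $P(|S_{k(n)}|\ge\varepsilon)\to 0$ for every $\varepsilon>0$. 3) Let $g$ be a real-valued function on the positive integers with $g(n)\to\infty$ and $g(n)=o(\log\log n)$ such that $k=k(n)=c_m(n)-g(n)$ is a non-negative integer for every $n\ge 2$. Then $P(S_{k(n)}=0)\to 0$ as $n\to\infty$. -/

import Mathlib

open Filter MeasureTheory ProbabilityTheory
open scoped NNReal ENNReal Topology Nat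

namespace CouponCollector

/-- The number of copies of coupon `i` among the first `t` coupons of the sequence `c`. -/
def copies {n : ℕ} (c : ℕ → Fin n) (t : ℕ) (i : Fin n) : ℕ :=
  ((Finset.range t).filter (fun s => c s = i)).card

/-- `T`: the least number of coupons after which each of the `n` types has been seen at least `m`
times. (On the null event that this never happens, the value is `0`.) -/
noncomputable def total {n : ℕ} (m : ℕ) (c : ℕ → Fin n) : ℕ :=
  sInf {t : ℕ | ∀ i : Fin n, m ≤ copies c t i}

/-- `S_k`: the number of `k`-tons, i.e. of types that have been seen exactly `k` times by the
time `T`. -/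
noncomputable def kTons {n : ℕ} (m k : ℕ) (c : ℕ → Fin n) : ℕ :=
  (Finset.univ.filter (fun i : Fin n => copies c (total m c) i = k)).card

/-- The coupon model: `C 0, C 1, …` are independent and uniformly distributed on the `n` types. -/
structure IsCouponSequence {Ω : Type*} [MeasurableSpace Ω] {n : ℕ} (C : ℕ → Ω → Fin n)
    (P : Measure Ω) : Prop where
  measurable : ∀ t, Measurable (C t)
  indep : iIndepFun C P
  uniform : ∀ (t : ℕ) (i : Fin n), P {ω | C t ω = i} = (n : ℝ≥0∞)⁻¹

/-- The normalized total `(T - n log n - (m - 1) n log log n) / n`. -/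
noncomputable def normalizedTotal {n : ℕ} (m : ℕ) (c : ℕ → Fin n) : ℝ :=
  ((total m c : ℝ) - n * Real.log n - ((m : ℝ) - 1) * n * Real.log (Real.log n)) / n

/-- The cumulative distribution function `x ↦ exp (-exp (-(x - μ) / β))` of the Gumbel
distribution. -/
noncomputable def gumbelCDF (μ β : ℝ) (hβ : 0 < β) : StieltjesFunction ℝ where
  toFun x := Real.exp (-Real.exp (-(x - μ) / β))
  mono' := by
    intro x y hxy
    have h : -(y - μ) / β ≤ -(x - μ) / β := by gcongr
    exact Real.exp_le_exp.2 (neg_le_neg (Real.exp_le_exp.2 h))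
  right_continuous' x := by
    apply Continuous.continuousWithinAt
    fun_prop

/-- The Gumbel distribution with location `μ` and scale `β`. -/
noncomputable def gumbel (μ β : ℝ) (hβ : 0 < β) : Measure ℝ := (gumbelCDF μ β hβ).measure

instance isProbabilityMeasure_gumbel (μ β : ℝ) (hβ : 0 < β) :
    IsProbabilityMeasure (gumbel μ β hβ) := by
  apply StieltjesFunction.isProbabilityMeasure
  · refine Real.tendsto_exp_atBot.comp (tendsto_neg_atTop_atBot.comp
      (Real.tendsto_exp_atTop.comp (Tendsto.atTop_div_const hβ
        (tendsto_neg_atBot_atTop.comp (tendsto_atBot_add_const_right _ (-μ) tendsto_id)))))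
  · have h : Tendsto (fun x : ℝ => -(x - μ) / β) atTop atBot :=
      Tendsto.atBot_div_const hβ
        (tendsto_neg_atTop_atBot.comp (tendsto_atTop_add_const_right _ (-μ) tendsto_id))
    have h2 := ((Real.continuous_exp.tendsto _).comp (Real.tendsto_exp_atBot.comp h).neg)
    rw [neg_zero, Real.exp_zero] at h2
    exact h2

/-- The Poisson parameter `exp ((e - 1) x - d) / √(2 π e)`; it is positive, so that `toNNReal`
does not change its value. -/
noncomputable def rate (d x : ℝ) : ℝ≥0 :=
  (Real.exp ((Real.exp 1 - 1) * x - d) / √(2 * Real.pi * Real.exp 1)).toNNReal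

theorem measurable_poisson_rate (d : ℝ) : Measurable fun x : ℝ => poissonMeasure (rate d x) := by
  refine Measure.measurable_of_measurable_coe _ fun s _ => ?_
  have hr : Measurable fun x : ℝ => (rate d x : ℝ) := by
    unfold rate
    fun_prop
  simp only [poissonMeasure, Measure.sum_apply _ (MeasurableSet.of_discrete (s := s)),
    Measure.smul_apply, smul_eq_mul]
  fun_prop

/-- The kernel `x ↦ Pois (exp ((e - 1) x - d) / √(2 π e))`. -/
noncomputable def poissonKernel (d : ℝ) : Kernel ℝ ℕ where
  toFun x := poissonMeasure (rate d x)
  measurable' := measurable_poisson_rate d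

instance isMarkovKernel_poissonKernel (d : ℝ) : IsMarkovKernel (poissonKernel d) :=
  ⟨fun x => inferInstanceAs (IsProbabilityMeasure (poissonMeasure (rate d x)))⟩

/-- The law of a pair `(X, Y)` with `X ∼ Gumbel (-log (m - 1)!, 1)` and, conditionally on `X`,
`Y ∼ Pois (exp ((e - 1) X - d) / √(2 π e))`. -/
noncomputable def limitLaw (m : ℕ) (d : ℝ) : Measure (ℝ × ℕ) :=
  (gumbel (-Real.log ((m - 1)! : ℕ)) 1 one_pos) ⊗ₘ (poissonKernel d)

instance isProbabilityMeasure_limitLaw (m : ℕ) (d : ℝ) : IsProbabilityMeasure (limitLaw m d) := by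
  unfold limitLaw
  infer_instance

/-- The centring `e log n + ((e - 1)(m - 1) - 1/2) log log n`. -/
noncomputable def centre (m n : ℕ) : ℝ :=
  Real.exp 1 * Real.log n
    + ((Real.exp 1 - 1) * ((m : ℝ) - 1) - 1 / 2) * Real.log (Real.log n)

end CouponCollector

open CouponCollector

/-! Put `s / n = τ = log n + (m - 1) log log n + x`. After `s` draws the counts of a bounded number
of types behave like independent Poisson variables of mean `τ`. Hence the expected number of types
with `m - 1` copies, and likewise that of types with fewer than `m`, tends to `a = exp (-x) / (m -
1)!`. A Poisson weight at `k = κ τ` is `exp (-τ (κ log κ - κ + 1))` up to a polynomial factor, so it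
has order `1 / n` at the exponential scale for `κ = e`. Stirling's formula then yields the `log log
n` correction in `centre` and the limit `q = exp ((e - 1) x - d) / √(2 π e)` of the expected number
of `k`-tons.

The collection ends with draw `s + 1` when the type drawn had `m - 1` copies and every other type at
least `m`. This draw is uniform and independent of the past, so `n P(T = s + 1, S_k = j)` is the
expected number of types `i` with `m - 1` copies such that no other type is below `m` and exactly
`j` others have `k` copies. Factorial moments and Bonferroni's inequality bound this below, in the
limit, by `a exp (-a) * exp (-q) q ^ j / j!`, the Gumbel density times a Poisson weight
(`le_liminf_kTons_eq`).

Lower bounds suffice: the limit already has total mass one. Fatou's lemma in `x` turns the local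
bounds into `liminf` bounds for events (`lintegral_le_liminf_measure`), and the portmanteau theorem
for open sets gives convergence in law. If `k` lies far above the centring, then `q = 0` and the
bound for `j = 0` integrates to one. If it lies far below, the mean number of `k`-tons diverges, and
a second moment bound (`le_liminf_kTons_ne_zero`) takes the place of the Poisson limit. -/

namespace CouponCollector

/-! ### Exact joint law of the numbers of copies. -/

section Counts

variable {Ω : Type*} {n : ℕ} {C : ℕ → Ω → Fin n}

/-- The vector of the numbers of copies of all the types among the first `t` coupons. -/
def counts (C : ℕ → Ω → Fin n) (t : ℕ) (ω : Ω) (i : Fin n) : ℕ :=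
  copies (fun s => C s ω) t i

lemma copies_zero (c : ℕ → Fin n) (i : Fin n) : copies c 0 i = 0 := by simp [copies]

lemma copies_succ (c : ℕ → Fin n) (t : ℕ) (i : Fin n) :
    copies c (t + 1) i = copies c t i + if c t = i then 1 else 0 := by
  unfold copies
  rw [Finset.range_add_one, Finset.filter_insert]
  split_ifs <;> simp

lemma copies_mono (c : ℕ → Fin n) (i : Fin n) : Monotone fun t => copies c t i :=
  monotone_nat_of_le_succ fun t => by simp [copies_succ]

lemma copies_eq_sum (c : ℕ → Fin n) (t : ℕ) (i : Fin n) :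
    copies c t i = ∑ s : Finset.range t, if c s = i then 1 else 0 := by
  rw [copies, Finset.card_filter, ← Finset.sum_coe_sort]

lemma counts_succ (t : ℕ) (ω : Ω) (i : Fin n) :
    counts C (t + 1) ω i = counts C t ω i + if C t ω = i then 1 else 0 :=
  copies_succ _ _ _

variable [MeasurableSpace Ω] {P : Measure Ω}

lemma IsCouponSequence.measurable_counts (hC : IsCouponSequence C P) (t : ℕ) :
    Measurable (counts C t) := by
  refine measurable_pi_lambda _ fun i => ?_
  induction t with
  | zero => simp [counts, copies_zero]
  | succ t ih =>
    simp only [counts_succ]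
    exact ih.add (Measurable.ite (hC.measurable t (measurableSet_singleton i))
      measurable_const measurable_const)

lemma IsCouponSequence.measurableSet_counts (hC : IsCouponSequence C P) (t : ℕ)
    (A : Set (Fin n → ℕ)) : MeasurableSet {ω | counts C t ω ∈ A} :=
  hC.measurable_counts t (MeasurableSet.of_discrete (s := A))

/-- The counts at time `t` are a function of the draws with index below `t`, hence independent of
the uniform draw `C t`. -/
lemma IsCouponSequence.measureReal_counts_inter (hC : IsCouponSequence C P) (t : ℕ)
    (A : Set (Fin n → ℕ)) (i : Fin n) :
    P.real {ω | counts C t ω ∈ A ∧ C t ω = i} = P.real {ω | counts C t ω ∈ A} / n := by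
  have h := hC.indep.indepFun_finset (Finset.range t) {t} (by simp) hC.measurable
  let F : (Finset.range t → Fin n) → Fin n → ℕ :=
    fun c i => ∑ s : Finset.range t, if c s = i then 1 else 0
  have hF_meas : Measurable F := Measurable.of_discrete
  have h2 := h.comp hF_meas
    (measurable_pi_apply (⟨t, by simp⟩ : ({t} : Finset ℕ)))
  have h3 := h2.measure_inter_preimage_eq_mul A {i} MeasurableSet.of_discrete
    (measurableSet_singleton i)
  have hF : (F ∘ fun a (s : Finset.range t) => C s a) = counts C t := by
    ext ω i
    simp [F, counts, copies_eq_sum]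
  rw [hF] at h3
  have h4 : P ((fun c : ({t} : Finset ℕ) → Fin n => c ⟨t, by simp⟩) ∘
      (fun a (s : ({t} : Finset ℕ)) => C s a) ⁻¹' {i}) = (n : ℝ≥0∞)⁻¹ := hC.uniform t i
  have h5 : P {ω | counts C t ω ∈ A ∧ C t ω = i} = P {ω | counts C t ω ∈ A} * (n : ℝ≥0∞)⁻¹ := by
    rw [← h4]
    exact h3
  rw [measureReal_def, h5, ENNReal.toReal_mul, ENNReal.toReal_inv, ENNReal.toReal_natCast,
    measureReal_def, div_eq_mul_inv]

/-- The probability that a set of `r` types, of which `s` copies in total are prescribed, has the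
prescribed numbers of copies among the first `t` coupons. -/
noncomputable def countWeight (n t r s : ℕ) : ℝ :=
  t.descFactorial s * ((n : ℝ)⁻¹) ^ s * (1 - r / n) ^ (t - s)

/-- The falling factorial identity `(t + 1)_{s+1} = (t)_{s+1} + (s + 1) (t)_s`. Its two terms match
the last draw falling outside or inside the set of `r` types. -/
lemma countWeight_succ_succ (n t r s : ℕ) :
    countWeight n (t + 1) r (s + 1) =
      (1 - r / n) * countWeight n t r (s + 1) + (n : ℝ)⁻¹ * (s + 1) * countWeight n t r s := by
  unfold countWeight
  -- The exponent `t - s` is truncated, but whenever it would be negative the falling factorial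
  -- vanishes.
  rcases lt_trichotomy s t with h | rfl | h
  · obtain ⟨u, rfl⟩ := Nat.exists_eq_add_of_lt h
    have e1 : s + u + 1 + 1 - (s + 1) = u + 1 := by omega
    have e2 : s + u + 1 - (s + 1) = u := by omega
    have e3 : s + u + 1 - s = u + 1 := by omega
    rw [Nat.succ_descFactorial_succ, Nat.descFactorial_succ, e1, e2, e3]
    push_cast
    ring
  · rw [Nat.succ_descFactorial_succ, Nat.descFactorial_succ]
    simp
    ring
  · rw [Nat.descFactorial_of_lt (by omega), Nat.descFactorial_of_lt (by omega),
      Nat.descFactorial_of_lt h]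
    simp

lemma countWeight_succ_zero (n t r : ℕ) :
    countWeight n (t + 1) r 0 = (1 - r / n) * countWeight n t r 0 := by
  simp [countWeight, pow_succ, mul_comm]

variable [IsProbabilityMeasure P]

/-- Split according to the last draw: it misses `I`, or it is some `i ∈ I`, which then had one copy
less before. The guard `b i = 0` excludes the truncated value of `b i - 1`. -/
lemma IsCouponSequence.measureReal_counts_succ (hC : IsCouponSequence C P) (hn : n ≠ 0) (t : ℕ)
    (I : Finset (Fin n)) (b : Fin n → ℕ) :
    P.real {ω | ∀ i ∈ I, counts C (t + 1) ω i = b i} =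
      (1 - I.card / n) * P.real {ω | ∀ i ∈ I, counts C t ω i = b i} +
      ∑ i ∈ I, (n : ℝ)⁻¹ * if b i = 0 then 0 else
        P.real {ω | ∀ j ∈ I, counts C t ω j = Function.update b i (b i - 1) j} := by
  have hsplit : P.real {ω | ∀ i ∈ I, counts C (t + 1) ω i = b i} =
      ∑ i, P.real {ω | (∀ j ∈ I, counts C t ω j + (if i = j then 1 else 0) = b j) ∧
        C t ω = i} := by
    rw [← measureReal_biUnion_finset]
    · congr 1
      ext ω
      simp [counts_succ]
    · intro i _ j _ hij
      refine Set.disjoint_left.2 fun ω h1 h2 => hij (h1.2.symm.trans h2.2)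
    · intro i _
      exact (hC.measurableSet_counts t {N | ∀ j ∈ I, N j + (if i = j then 1 else 0) = b j}).inter
        (hC.measurable t (measurableSet_singleton i))
  have hterm : ∀ i, P.real {ω | (∀ j ∈ I, counts C t ω j + (if i = j then 1 else 0) = b j) ∧
        C t ω = i} =
      P.real {ω | ∀ j ∈ I, counts C t ω j + (if i = j then 1 else 0) = b j} * (n : ℝ)⁻¹ :=
    fun i => (hC.measureReal_counts_inter t
      {N | ∀ j ∈ I, N j + (if i = j then 1 else 0) = b j} i).trans (div_eq_mul_inv _ _)
  rw [hsplit]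
  simp only [hterm]
  rw [← Finset.sum_compl_add_sum I]
  congr 1
  · rw [Finset.sum_congr rfl (g := fun _ => P.real {ω | ∀ i ∈ I, counts C t ω i = b i} * (n : ℝ)⁻¹)]
    · rw [Finset.sum_const, Finset.card_compl, Fintype.card_fin, nsmul_eq_mul,
        Nat.cast_sub (by simpa using Finset.card_le_univ I)]
      have : (n : ℝ) ≠ 0 := by exact_mod_cast hn
      field_simp
    · intro i hi
      congr 3
      ext ω
      refine forall₂_congr fun j hj => ?_
      rw [if_neg, add_zero]
      rintro rfl
      exact Finset.mem_compl.1 hi hj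
  · refine Finset.sum_congr rfl fun i hi => ?_
    rw [mul_comm]
    congr 1
    split_ifs with h0
    · rw [← measureReal_empty (μ := P)]
      congr 1
      refine Set.eq_empty_of_forall_notMem fun ω hω => ?_
      have := hω i hi
      simp [h0] at this
    · congr 2
      ext ω
      refine forall₂_congr fun j hj => ?_
      rcases eq_or_ne i j with rfl | hij
      · simp; omega
      · simp [hij, Function.update_of_ne hij.symm]

theorem IsCouponSequence.measureReal_counts_eq (hC : IsCouponSequence C P) (hn : n ≠ 0) (t : ℕ)
    (I : Finset (Fin n)) (b : Fin n → ℕ) :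
    P.real {ω | ∀ i ∈ I, counts C t ω i = b i} =
      countWeight n t I.card (∑ i ∈ I, b i) * ∏ i ∈ I, ((b i)! : ℝ)⁻¹ := by
  induction t generalizing b with
  | zero =>
    simp only [counts, copies_zero]
    by_cases h : ∀ i ∈ I, 0 = b i
    · have h1 : ∑ i ∈ I, b i = 0 := Finset.sum_eq_zero fun i hi => (h i hi).symm
      have h2 : ∏ i ∈ I, ((b i)! : ℝ)⁻¹ = 1 :=
        Finset.prod_eq_one fun i hi => by simp [← h i hi]
      rw [h1, h2]
      have h3 : {ω : Ω | ∀ i ∈ I, 0 = b i} = Set.univ := by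
        simpa [Set.eq_univ_iff_forall] using fun _ : Ω => h
      simp [h3, countWeight]
    · have h1 : ∑ i ∈ I, b i ≠ 0 := fun h0 =>
        h fun i hi => (Finset.sum_eq_zero_iff.1 h0 i hi).symm
      simp [h, countWeight, Nat.descFactorial_of_lt (Nat.pos_of_ne_zero h1)]
  | succ t ih =>
    rw [hC.measureReal_counts_succ hn]
    simp only [ih]
    -- Removing a copy of `i` multiplies the product of inverse factorials by `b i`. Summed over
    -- `I`, these factors give the total number of copies, which is the coefficient in
    -- `countWeight_succ_succ`.
    have hupd : ∀ i ∈ I, ((n : ℝ)⁻¹ * if b i = 0 then 0 else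
        countWeight n t I.card (∑ j ∈ I, Function.update b i (b i - 1) j) *
          ∏ j ∈ I, ((Function.update b i (b i - 1) j)! : ℝ)⁻¹) =
        b i * ((n : ℝ)⁻¹ * countWeight n t I.card ((∑ j ∈ I, b j) - 1) *
          ∏ j ∈ I, ((b j)! : ℝ)⁻¹) := by
      intro i hi
      split_ifs with h0
      · simp [h0]
      · have e1 : ∑ j ∈ I, Function.update b i (b i - 1) j = (∑ j ∈ I, b j) - 1 := by
          rw [Finset.sum_update_of_mem hi, ← Finset.add_sum_erase I b hi,
            Finset.sdiff_singleton_eq_erase]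
          omega
        have e2 : ∏ j ∈ I, ((Function.update b i (b i - 1) j)! : ℝ)⁻¹ =
            b i * ∏ j ∈ I, ((b j)! : ℝ)⁻¹ := by
          rw [← Finset.mul_prod_erase I _ hi, ← Finset.mul_prod_erase I _ hi,
            Function.update_self, ← mul_assoc]
          congr 1
          · rw [← Nat.mul_factorial_pred h0]
            have : (b i : ℝ) ≠ 0 := by exact_mod_cast h0
            have := Nat.factorial_ne_zero (b i - 1)
            push_cast
            field_simp
          · refine Finset.prod_congr rfl fun j hj => ?_
            rw [Function.update_of_ne (Finset.ne_of_mem_erase hj)]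
        rw [e1, e2]
        ring
    rw [Finset.sum_congr rfl hupd, ← Finset.sum_mul, ← Nat.cast_sum]
    rcases Nat.eq_zero_or_eq_succ_pred (∑ i ∈ I, b i) with h | h
    · rw [h, countWeight_succ_zero]
      simp
      ring
    · rw [h, Nat.succ_eq_add_one, countWeight_succ_succ]
      push_cast
      ring

end Counts

/-! ### Comparison with products of Poisson weights. -/

/-- The Poisson weight `exp (-τ) τ ^ b / b!`. -/
noncomputable def poissonWeight (τ : ℝ) (b : ℕ) : ℝ := Real.exp (-τ) * τ ^ b / b !

/-- The total Poisson weight of a finite set. -/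
noncomputable def poissonMass (τ : ℝ) (B : Finset ℕ) : ℝ := ∑ b ∈ B, poissonWeight τ b

lemma poissonWeight_nonneg {τ : ℝ} (hτ : 0 ≤ τ) (b : ℕ) : 0 ≤ poissonWeight τ b := by
  unfold poissonWeight
  positivity

@[simp] lemma poissonMass_singleton (τ : ℝ) (b : ℕ) : poissonMass τ {b} = poissonWeight τ b :=
  Finset.sum_singleton _ _

/-- The factor in the upper bound of counting probabilities by products of Poisson weights. -/
noncomputable def upperFactor (n K r : ℕ) : ℝ := Real.exp (r ^ 2 * K / n)

/-- The factor in the lower bound of counting probabilities by products of Poisson weights. -/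
noncomputable def lowerFactor (n t K r : ℕ) : ℝ :=
  (1 - (r * K : ℝ) ^ 2 / t) * (1 - (r : ℝ) ^ 2 * t / n ^ 2)

lemma countWeight_le {n t r s K : ℕ} (hn : n ≠ 0) (hr : r ≤ n) (hs : s ≤ r * K) :
    countWeight n t r s ≤
      upperFactor n K r * (Real.exp (-(t / n)) ^ r * ((t : ℝ) / n) ^ s) := by
  have hn0 : (0 : ℝ) < n := by exact_mod_cast Nat.pos_of_ne_zero hn
  unfold upperFactor
  rcases le_or_gt s t with hst | hst
  · have h0 : (0 : ℝ) ≤ 1 - r / n := by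
      rw [sub_nonneg, div_le_one hn0]
      exact_mod_cast hr
    have h1 : (t.descFactorial s : ℝ) ≤ (t : ℝ) ^ s := by
      exact_mod_cast Nat.descFactorial_le_pow t s
    -- The missing `s` in the exponent costs `exp (r s / n)`, and `s ≤ r K` bounds this by the upper
    -- factor.
    have h2 : (1 - (r : ℝ) / n) ^ (t - s) ≤
        Real.exp (r ^ 2 * K / n) * Real.exp (-(t / n)) ^ r := by
      calc (1 - (r : ℝ) / n) ^ (t - s) ≤ Real.exp (-(r / n)) ^ (t - s) :=
            pow_le_pow_left₀ h0 (Real.one_sub_le_exp_neg _) _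
        _ = Real.exp (r * s / n) * Real.exp (-(t / n)) ^ r := by
            rw [← Real.exp_nat_mul, ← Real.exp_nat_mul, ← Real.exp_add]
            congr 1
            push_cast [hst]
            field_simp
            ring
        _ ≤ _ := by
            have : (s : ℝ) ≤ r * K := by exact_mod_cast hs
            refine mul_le_mul_of_nonneg_right (Real.exp_le_exp.2
              (div_le_div_of_nonneg_right ?_ hn0.le)) (by positivity)
            nlinarith [(Nat.cast_nonneg r : (0 : ℝ) ≤ r)]
    calc countWeight n t r s
        ≤ (t : ℝ) ^ s * ((n : ℝ)⁻¹) ^ s *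
            (Real.exp (r ^ 2 * K / n) * Real.exp (-(t / n)) ^ r) := by
          unfold countWeight
          gcongr
      _ = _ := by
          rw [div_eq_mul_inv (t : ℝ), mul_pow]
          ring
  · rw [countWeight, Nat.descFactorial_of_lt hst]
    simp only [Nat.cast_zero, zero_mul]
    positivity

lemma le_countWeight {n t r s K : ℕ} (hn : n ≠ 0) (ht : t ≠ 0) (hr : r ≤ n) (hs : s ≤ r * K)
    (hK : (r * K) ^ 2 ≤ t) (hrt : r ^ 2 * t ≤ n ^ 2) :
    lowerFactor n t K r * (Real.exp (-(t / n)) ^ r * ((t : ℝ) / n) ^ s) ≤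
      countWeight n t r s := by
  have hn0 : (0 : ℝ) < n := by exact_mod_cast Nat.pos_of_ne_zero hn
  have ht0 : (0 : ℝ) < t := by exact_mod_cast Nat.pos_of_ne_zero ht
  have hst : s ≤ t := hs.trans ((Nat.le_self_pow two_ne_zero _).trans hK)
  have hrn : (r : ℝ) / n ≤ 1 := by
    rw [div_le_one hn0]
    exact_mod_cast hr
  have hrn0 : (0 : ℝ) ≤ r / n := by positivity
  have h0 : (0 : ℝ) ≤ 1 - r / n := sub_nonneg.2 hrn
  have h1 : (1 - (r * K : ℝ) ^ 2 / t) * (t : ℝ) ^ s ≤ t.descFactorial s := by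
    have hs' : (s : ℝ) ≤ r * K := by exact_mod_cast hs
    -- Bernoulli's inequality.
    have h3 : 1 - (r * K : ℝ) ^ 2 / t ≤ (1 - (s : ℝ) / t) ^ s := by
      have := one_add_mul_le_pow (a := -((s : ℝ) / t)) (by
        have : (s : ℝ) / t ≤ 1 := by
          rw [div_le_one ht0]
          exact_mod_cast hst
        linarith) s
      calc 1 - (r * K : ℝ) ^ 2 / t ≤ 1 - (s : ℝ) ^ 2 / t := by gcongr
        _ = 1 + s * (-((s : ℝ) / t)) := by ring
        _ ≤ _ := by simpa [sub_eq_add_neg] using this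
    calc (1 - (r * K : ℝ) ^ 2 / t) * (t : ℝ) ^ s ≤ (1 - (s : ℝ) / t) ^ s * (t : ℝ) ^ s := by
          gcongr
      _ = ((t : ℝ) - s) ^ s := by
          rw [← mul_pow]
          congr 1
          field_simp
      _ ≤ ((t + 1 - s : ℕ) : ℝ) ^ s := by
          gcongr
          · have : (s : ℝ) ≤ t := by exact_mod_cast hst
            linarith
          · push_cast [hst.trans (Nat.le_succ t)]
            linarith
      _ ≤ _ := by exact_mod_cast Nat.pow_sub_le_descFactorial t s
  have h2 : (1 - (r : ℝ) ^ 2 * t / n ^ 2) * Real.exp (-(t / n)) ^ r ≤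
      (1 - (r : ℝ) / n) ^ (t - s) := by
    have e1 : Real.exp (-(t / n)) ^ r = (Real.exp (r / n) ^ t)⁻¹ := by
      rw [← Real.exp_nat_mul, ← Real.exp_nat_mul, ← Real.exp_neg]
      congr 1
      ring
    calc (1 - (r : ℝ) ^ 2 * t / n ^ 2) * Real.exp (-(t / n)) ^ r
        ≤ (1 - (r : ℝ) / n) ^ t := by
          rw [e1, ← div_eq_mul_inv, div_le_iff₀ (by positivity), ← mul_pow]
          -- Bernoulli's inequality again, after `1 - y ^ 2 = (1 - y) (1 + y) ≤ (1 - y) exp y` with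
          -- `y = r / n`.
          have h4 := one_add_mul_le_pow (a := -((r : ℝ) / n) ^ 2) (by nlinarith) t
          calc 1 - (r : ℝ) ^ 2 * t / n ^ 2 = 1 + t * (-((r : ℝ) / n) ^ 2) := by ring
            _ ≤ (1 + -((r : ℝ) / n) ^ 2) ^ t := h4
            _ ≤ _ := by
              apply pow_le_pow_left₀
              · nlinarith
              · nlinarith [Real.add_one_le_exp ((r : ℝ) / n)]
      _ ≤ _ := pow_le_pow_of_le_one h0 (by linarith) (Nat.sub_le _ _)
  have h5 : 0 ≤ 1 - (r : ℝ) ^ 2 * t / n ^ 2 := by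
    rw [sub_nonneg, div_le_one (by positivity)]
    exact_mod_cast hrt
  calc lowerFactor n t K r * (Real.exp (-(t / n)) ^ r * ((t : ℝ) / n) ^ s)
      = ((1 - (r * K : ℝ) ^ 2 / t) * (t : ℝ) ^ s) * ((n : ℝ)⁻¹) ^ s *
          ((1 - (r : ℝ) ^ 2 * t / n ^ 2) * Real.exp (-(t / n)) ^ r) := by
        rw [lowerFactor, div_eq_mul_inv (t : ℝ) n, mul_pow]
        ring
    _ ≤ _ := by
        unfold countWeight
        gcongr

lemma prod_poissonWeight {ι : Type*} (τ : ℝ) (I : Finset ι) (b : ι → ℕ) :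
    ∏ i ∈ I, poissonWeight τ (b i) =
      Real.exp (-τ) ^ I.card * τ ^ (∑ i ∈ I, b i) * ∏ i ∈ I, ((b i)! : ℝ)⁻¹ := by
  simp only [poissonWeight, div_eq_mul_inv, Finset.prod_mul_distrib, Finset.prod_const,
    Finset.prod_pow_eq_pow_sum]

variable {Ω : Type*} {n : ℕ} {C : ℕ → Ω → Fin n}

variable [MeasurableSpace Ω] {P : Measure Ω} [IsProbabilityMeasure P]

/-- Outside `I` the patterns `p` are pinned to `0`, so that each choice of counts on `I` is summed
exactly once. -/
lemma IsCouponSequence.measureReal_counts_mem (hC : IsCouponSequence C P) (t : ℕ)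
    (I : Finset (Fin n)) (B : Fin n → Finset ℕ) :
    P.real {ω | ∀ i ∈ I, counts C t ω i ∈ B i} =
      ∑ p ∈ Fintype.piFinset (fun i => if i ∈ I then B i else {0}),
        P.real {ω | ∀ i ∈ I, counts C t ω i = p i} := by
  rw [← measureReal_biUnion_finset]
  · congr 1
    ext ω
    simp only [Set.mem_ofPred_eq, Set.mem_iUnion, Fintype.mem_piFinset, exists_prop]
    constructor
    · intro h
      refine ⟨fun i => if i ∈ I then counts C t ω i else 0, fun i => ?_, fun i hi => ?_⟩
      · by_cases hi : i ∈ I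
        · simpa [hi] using h i hi
        · simp [hi]
      · simp [hi]
    · rintro ⟨p, hp, h⟩ i hi
      have := hp i
      rw [if_pos hi, ← h i hi] at this
      exact this
  · intro p hp q hq hpq
    refine Set.disjoint_left.2 fun ω h1 h2 => hpq ?_
    ext i
    by_cases hi : i ∈ I
    · exact (h1 i hi).symm.trans (h2 i hi)
    · have e1 := Fintype.mem_piFinset.1 hp i
      have e2 := Fintype.mem_piFinset.1 hq i
      simp only [hi, if_false, Finset.mem_singleton] at e1 e2
      rw [e1, e2]
  · intro p _
    exact hC.measurableSet_counts t {N | ∀ i ∈ I, N i = p i}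

lemma prod_poissonMass {ι : Type*} [Fintype ι] [DecidableEq ι] (τ : ℝ) (I : Finset ι)
    (B : ι → Finset ℕ) :
    ∏ i ∈ I, poissonMass τ (B i) =
      ∑ p ∈ Fintype.piFinset (fun i => if i ∈ I then B i else {0}),
        ∏ i ∈ I, poissonWeight τ (p i) := by
  have h := Finset.prod_univ_sum (fun i => if i ∈ I then B i else {0})
    (fun i b => if i ∈ I then poissonWeight τ b else 1)
  simp only [Finset.prod_ite_mem, Finset.univ_inter] at h
  rw [← h, ← Finset.prod_subset (Finset.subset_univ I)]
  · refine Finset.prod_congr rfl fun i hi => ?_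
    simp [hi, poissonMass]
  · intro i _ hi
    simp [hi]

lemma sum_le_card_mul_of_mem_piFinset {ι : Type*} [Fintype ι] [DecidableEq ι] {I : Finset ι}
    {B : ι → Finset ℕ} {K : ℕ} (hB : ∀ i ∈ I, B i ⊆ Finset.range (K + 1)) {p : ι → ℕ}
    (hp : p ∈ Fintype.piFinset (fun i => if i ∈ I then B i else {0})) :
    ∑ i ∈ I, p i ≤ I.card * K := by
  refine (Finset.sum_le_card_nsmul I p K fun i hi => ?_).trans_eq (smul_eq_mul _ _)
  have := Fintype.mem_piFinset.1 hp i
  rw [if_pos hi] at this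
  exact Nat.lt_succ_iff.1 (Finset.mem_range.1 (hB i hi this))

/-- All patterns have at most `I.card * K` copies in total, so a single error factor serves for the
whole sum. -/
theorem IsCouponSequence.measureReal_counts_mem_le (hC : IsCouponSequence C P) (hn : n ≠ 0)
    (t : ℕ) {K : ℕ} (I : Finset (Fin n)) (B : Fin n → Finset ℕ)
    (hB : ∀ i ∈ I, B i ⊆ Finset.range (K + 1)) :
    P.real {ω | ∀ i ∈ I, counts C t ω i ∈ B i} ≤
      upperFactor n K I.card * ∏ i ∈ I, poissonMass (t / n) (B i) := by
  rw [hC.measureReal_counts_mem, prod_poissonMass, Finset.mul_sum]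
  refine Finset.sum_le_sum fun p hp => ?_
  rw [hC.measureReal_counts_eq hn, prod_poissonWeight, ← mul_assoc]
  gcongr
  exact countWeight_le hn (by simpa using Finset.card_le_univ I)
    (sum_le_card_mul_of_mem_piFinset hB hp)

theorem IsCouponSequence.le_measureReal_counts_mem (hC : IsCouponSequence C P) (hn : n ≠ 0)
    {t : ℕ} (ht : t ≠ 0) {K : ℕ} (I : Finset (Fin n)) (B : Fin n → Finset ℕ)
    (hB : ∀ i ∈ I, B i ⊆ Finset.range (K + 1)) (hK : (I.card * K) ^ 2 ≤ t)
    (hI : I.card ^ 2 * t ≤ n ^ 2) :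
    lowerFactor n t K I.card * ∏ i ∈ I, poissonMass (t / n) (B i) ≤
      P.real {ω | ∀ i ∈ I, counts C t ω i ∈ B i} := by
  rw [hC.measureReal_counts_mem, prod_poissonMass, Finset.mul_sum]
  refine Finset.sum_le_sum fun p hp => ?_
  rw [hC.measureReal_counts_eq hn, prod_poissonWeight, ← mul_assoc]
  gcongr
  exact le_countWeight hn ht (by simpa using Finset.card_le_univ I)
    (sum_le_card_mul_of_mem_piFinset hB hp) hK hI

/-! ### Expected numbers of tuples of types with prescribed counts. -/

/-- The number of types other than `i` whose number of copies lies in `B`. -/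
def othersIn {n : ℕ} (N : Fin n → ℕ) (B : Finset ℕ) (i : Fin n) : ℕ :=
  ((Finset.univ.erase i).filter (fun l => N l ∈ B)).card

/-- The number of triples of a type with `c` copies, a `j`-set of other types with `k` copies, and
an `r`-set of further types whose numbers of copies lie in `B` (if `k ∈ B` or `j = 0`). -/
noncomputable def tupleCount {n : ℕ} (c k j r : ℕ) (B : Finset ℕ) (N : Fin n → ℕ) : ℝ :=
  ∑ i, if N i = c then ((othersIn N {k} i).choose j : ℝ) * ((othersIn N B i - j).choose r : ℝ)
    else 0

lemma sum_powersetCard_ite {ι : Type*} [DecidableEq ι] (A : Finset ι) (p : ι → Prop)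
    [DecidablePred p] (r : ℕ) :
    ∑ L ∈ A.powersetCard r, (if ∀ l ∈ L, p l then (1 : ℝ) else 0) =
      ((A.filter p).card.choose r : ℝ) := by
  rw [← Finset.sum_filter, Finset.sum_const, nsmul_eq_mul, mul_one, ← Finset.card_powersetCard]
  congr 2
  ext L
  simp only [Finset.mem_filter, Finset.mem_powersetCard, Finset.subset_iff]
  grind

/-- If `p` implies `q`, an admissible `J` uses up `j` of the elements with `q`, whichever `J` it is.
For `j = 0` nothing is used up and no implication is needed. -/
lemma sum_sum_powersetCard_ite {ι : Type*} [DecidableEq ι] (A : Finset ι) (p q : ι → Prop)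
    [DecidablePred p] [DecidablePred q] (j r : ℕ) (h : (∀ l, p l → q l) ∨ j = 0) :
    ∑ J ∈ A.powersetCard j, ∑ L ∈ (A \ J).powersetCard r,
      (if (∀ l ∈ J, p l) ∧ ∀ l ∈ L, q l then (1 : ℝ) else 0) =
      ((A.filter p).card.choose j : ℝ) * (((A.filter q).card - j).choose r : ℝ) := by
  rw [← sum_powersetCard_ite A p j, Finset.sum_mul]
  refine Finset.sum_congr rfl fun J hJ => ?_
  rw [Finset.mem_powersetCard] at hJ
  by_cases hp : ∀ l ∈ J, p l
  · rw [if_pos hp, one_mul]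
    simp only [and_iff_right hp]
    rw [sum_powersetCard_ite]
    congr 2
    have hsub : J ⊆ A.filter q := by
      intro l hl
      refine Finset.mem_filter.2 ⟨hJ.1 hl, ?_⟩
      rcases h with h | rfl
      · exact h l (hp l hl)
      · rw [Finset.card_eq_zero] at hJ
        simp [hJ.2] at hl
    rw [← hJ.2, ← Finset.card_sdiff_of_subset hsub]
    congr 1
    ext l
    simp only [Finset.mem_filter, Finset.mem_sdiff]
    tauto
  · simp [hp]

lemma tupleCount_eq_sum {n : ℕ} {c k j r : ℕ} {B : Finset ℕ} (h : k ∈ B ∨ j = 0)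
    (N : Fin n → ℕ) :
    tupleCount c k j r B N = ∑ i, ∑ J ∈ (Finset.univ.erase i).powersetCard j,
      ∑ L ∈ (Finset.univ.erase i \ J).powersetCard r,
        if N i = c ∧ (∀ l ∈ J, N l = k) ∧ ∀ l ∈ L, N l ∈ B then (1 : ℝ) else 0 := by
  refine Finset.sum_congr rfl fun i _ => ?_
  by_cases hi : N i = c
  · simp only [hi, if_true, true_and]
    have := sum_sum_powersetCard_ite (Finset.univ.erase i) (fun l => N l = k) (fun l => N l ∈ B) j r
      (h.imp_left fun h l hl => by rwa [hl])
    simp only [othersIn, Finset.mem_singleton]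
    convert this.symm
  · simp [hi]

variable {Ω : Type*} {n : ℕ} {C : ℕ → Ω → Fin n}

variable [MeasurableSpace Ω] {P : Measure Ω}

lemma IsCouponSequence.integral_ite (hC : IsCouponSequence C P) (t : ℕ)
    (p : (Fin n → ℕ) → Prop) [DecidablePred p] :
    ∫ ω, (if p (counts C t ω) then (1 : ℝ) else 0) ∂P = P.real {ω | p (counts C t ω)} := by
  refine Eq.trans ?_ (integral_indicator_one (hC.measurableSet_counts t {N | p N}))
  refine integral_congr_ae (Eventually.of_forall fun ω => ?_)
  simp [Set.indicator_apply]

variable [IsProbabilityMeasure P]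

lemma IsCouponSequence.integrable_ite (hC : IsCouponSequence C P) (t : ℕ)
    (p : (Fin n → ℕ) → Prop) [DecidablePred p] :
    Integrable (fun ω => if p (counts C t ω) then (1 : ℝ) else 0) P := by
  have h := (integrable_const (μ := P) (1 : ℝ)).indicator (hC.measurableSet_counts t {N | p N})
  refine h.congr (Eventually.of_forall fun ω => ?_)
  simp [Set.indicator_apply]

lemma IsCouponSequence.integrable_tupleCount (hC : IsCouponSequence C P) (t : ℕ) {c k j r : ℕ}
    {B : Finset ℕ} (h : k ∈ B ∨ j = 0) :
    Integrable (fun ω => tupleCount c k j r B (counts C t ω)) P := by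
  simp only [tupleCount_eq_sum h]
  exact integrable_finsetSum _ fun i _ => integrable_finsetSum _ fun J _ =>
    integrable_finsetSum _ fun L _ => hC.integrable_ite t
      fun N => N i = c ∧ (∀ l ∈ J, N l = k) ∧ ∀ l ∈ L, N l ∈ B

lemma IsCouponSequence.integral_tupleCount (hC : IsCouponSequence C P) (t : ℕ) {c k j r : ℕ}
    {B : Finset ℕ} (h : k ∈ B ∨ j = 0) :
    ∫ ω, tupleCount c k j r B (counts C t ω) ∂P =
      ∑ i, ∑ J ∈ (Finset.univ.erase i).powersetCard j,
      ∑ L ∈ (Finset.univ.erase i \ J).powersetCard r,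
        P.real {ω | counts C t ω i = c ∧ (∀ l ∈ J, counts C t ω l = k) ∧
          ∀ l ∈ L, counts C t ω l ∈ B} := by
  simp only [tupleCount_eq_sum h]
  have hI : ∀ (i : Fin n) (J L : Finset (Fin n)), Integrable (fun ω => if counts C t ω i = c ∧
      (∀ l ∈ J, counts C t ω l = k) ∧ ∀ l ∈ L, counts C t ω l ∈ B then (1 : ℝ) else 0) P :=
    fun i J L => hC.integrable_ite t
      fun N => N i = c ∧ (∀ l ∈ J, N l = k) ∧ ∀ l ∈ L, N l ∈ B
  rw [integral_finsetSum _ fun i _ => integrable_finsetSum _ fun J _ =>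
    integrable_finsetSum _ fun L _ => hI i J L]
  refine Finset.sum_congr rfl fun i _ => ?_
  rw [integral_finsetSum _ fun J _ => integrable_finsetSum _ fun L _ => hI i J L]
  refine Finset.sum_congr rfl fun J _ => ?_
  rw [integral_finsetSum _ fun L _ => hI i J L]
  exact Finset.sum_congr rfl fun L _ => hC.integral_ite t
      fun N => N i = c ∧ (∀ l ∈ J, N l = k) ∧ ∀ l ∈ L, N l ∈ B

/-- The approximate value of the expectation of `tupleCount`. -/
noncomputable def tupleMean (n : ℕ) (τ : ℝ) (c k j r : ℕ) (B : Finset ℕ) : ℝ :=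
  n * (n - 1).choose j * (n - 1 - j).choose r *
    (poissonWeight τ c * poissonWeight τ k ^ j * poissonMass τ B ^ r)

lemma sum_sum_sum_const (n j r : ℕ) (x : ℝ) :
    ∑ i : Fin n, ∑ J ∈ (Finset.univ.erase i).powersetCard j,
      ∑ _L ∈ (Finset.univ.erase i \ J).powersetCard r, x =
      n * (n - 1).choose j * (n - 1 - j).choose r * x := by
  have h : ∀ i : Fin n, ∀ J ∈ (Finset.univ.erase i).powersetCard j,
      ∑ _L ∈ (Finset.univ.erase i \ J).powersetCard r, x = (n - 1 - j).choose r * x := by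
    intro i J hJ
    rw [Finset.mem_powersetCard] at hJ
    rw [Finset.sum_const, Finset.card_powersetCard, Finset.card_sdiff_of_subset hJ.1, hJ.2]
    simp
  rw [Finset.sum_congr rfl fun i _ => Finset.sum_congr rfl (h i)]
  simp
  ring

/-- The family of sets that prescribes `c` copies of `i`, `k` copies of the members of `J`, and
otherwise a number of copies in `B`. -/
def tupleSets {n : ℕ} (c k : ℕ) (B : Finset ℕ) (i : Fin n) (J : Finset (Fin n)) (l : Fin n) :
    Finset ℕ :=
  if l = i then {c} else if l ∈ J then {k} else B

lemma tuple_disjoint {n : ℕ} {i : Fin n} {J L : Finset (Fin n)} {j r : ℕ}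
    (hJ : J ∈ (Finset.univ.erase i).powersetCard j)
    (hL : L ∈ (Finset.univ.erase i \ J).powersetCard r) :
    i ∉ J ∪ L ∧ Disjoint J L ∧ J.card = j ∧ L.card = r := by
  rw [Finset.mem_powersetCard] at hJ hL
  refine ⟨?_, ?_, hJ.2, hL.2⟩
  · rw [Finset.mem_union, not_or]
    refine ⟨fun h => ?_, fun h => ?_⟩
    · simpa using hJ.1 h
    · simpa using hL.1 h
  · exact Finset.disjoint_left.2 fun l h1 h2 => (Finset.mem_sdiff.1 (hL.1 h2)).2 h1

lemma tuple_card {n : ℕ} {i : Fin n} {J L : Finset (Fin n)} {j r : ℕ}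
    (hJ : J ∈ (Finset.univ.erase i).powersetCard j)
    (hL : L ∈ (Finset.univ.erase i \ J).powersetCard r) :
    (insert i (J ∪ L)).card = 1 + j + r := by
  obtain ⟨h1, h2, h3, h4⟩ := tuple_disjoint hJ hL
  rw [Finset.card_insert_of_notMem h1, Finset.card_union_of_disjoint h2, h3, h4]
  ring

lemma tuple_prod {n : ℕ} {i : Fin n} {J L : Finset (Fin n)} {c k j r : ℕ} {B : Finset ℕ} (τ : ℝ)
    (hJ : J ∈ (Finset.univ.erase i).powersetCard j)
    (hL : L ∈ (Finset.univ.erase i \ J).powersetCard r) :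
    ∏ l ∈ insert i (J ∪ L), poissonMass τ (tupleSets c k B i J l) =
      poissonWeight τ c * poissonWeight τ k ^ j * poissonMass τ B ^ r := by
  obtain ⟨h1, h2, h3, h4⟩ := tuple_disjoint hJ hL
  have h5 : ∀ l ∈ J, poissonMass τ (tupleSets c k B i J l) = poissonWeight τ k := by
    intro l hl
    have : l ≠ i := by
      rintro rfl
      exact h1 (Finset.mem_union_left _ hl)
    simp [tupleSets, this, hl]
  have h6 : ∀ l ∈ L, poissonMass τ (tupleSets c k B i J l) = poissonMass τ B := by
    intro l hl
    have : l ≠ i := by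
      rintro rfl
      exact h1 (Finset.mem_union_right _ hl)
    simp [tupleSets, this, Finset.disjoint_right.1 h2 hl]
  rw [Finset.prod_insert h1, Finset.prod_union h2, Finset.prod_congr rfl h5,
    Finset.prod_congr rfl h6, Finset.prod_const, Finset.prod_const, h3, h4, ← mul_assoc]
  simp [tupleSets]

lemma tuple_event {n : ℕ} {i : Fin n} {J L : Finset (Fin n)} {c k j r : ℕ} {B : Finset ℕ}
    (hJ : J ∈ (Finset.univ.erase i).powersetCard j)
    (hL : L ∈ (Finset.univ.erase i \ J).powersetCard r) (N : Fin n → ℕ) :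
    (N i = c ∧ (∀ l ∈ J, N l = k) ∧ ∀ l ∈ L, N l ∈ B) ↔
      ∀ l ∈ insert i (J ∪ L), N l ∈ tupleSets c k B i J l := by
  obtain ⟨h1, h2, -, -⟩ := tuple_disjoint hJ hL
  rw [Finset.disjoint_left] at h2
  simp only [Finset.mem_insert, Finset.mem_union, tupleSets] at h1 ⊢
  grind

lemma tupleSets_subset {n : ℕ} {c k K : ℕ} {B : Finset ℕ} (hc : c ≤ K) (hk : k ≤ K)
    (hB : B ⊆ Finset.range (K + 1)) (i : Fin n) (J : Finset (Fin n)) (l : Fin n) :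
    tupleSets c k B i J l ⊆ Finset.range (K + 1) := by
  unfold tupleSets
  split_ifs
  · simpa using Nat.lt_succ_of_le hc
  · simpa using Nat.lt_succ_of_le hk
  · exact hB

theorem IsCouponSequence.integral_tupleCount_le (hC : IsCouponSequence C P) (hn : n ≠ 0) (t : ℕ)
    {c k j r K : ℕ} {B : Finset ℕ} (h : k ∈ B ∨ j = 0) (hc : c ≤ K) (hk : k ≤ K)
    (hB : B ⊆ Finset.range (K + 1)) :
    ∫ ω, tupleCount c k j r B (counts C t ω) ∂P ≤
      upperFactor n K (1 + j + r) * tupleMean n (t / n) c k j r B := by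
  rw [hC.integral_tupleCount t h, tupleMean, mul_left_comm, ← sum_sum_sum_const]
  refine Finset.sum_le_sum fun i _ => Finset.sum_le_sum fun J hJ =>
    Finset.sum_le_sum fun L hL => ?_
  have := hC.measureReal_counts_mem_le hn t (insert i (J ∪ L)) (tupleSets c k B i J)
    (fun l _ => tupleSets_subset hc hk hB i J l)
  rw [tuple_prod _ hJ hL, tuple_card hJ hL] at this
  simpa only [tuple_event hJ hL] using this

theorem IsCouponSequence.le_integral_tupleCount (hC : IsCouponSequence C P) (hn : n ≠ 0) {t : ℕ}
    (ht : t ≠ 0) {c k j r K : ℕ} {B : Finset ℕ} (h : k ∈ B ∨ j = 0) (hc : c ≤ K) (hk : k ≤ K)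
    (hB : B ⊆ Finset.range (K + 1)) (hK : ((1 + j + r) * K) ^ 2 ≤ t)
    (hr : (1 + j + r) ^ 2 * t ≤ n ^ 2) :
    lowerFactor n t K (1 + j + r) * tupleMean n (t / n) c k j r B ≤
      ∫ ω, tupleCount c k j r B (counts C t ω) ∂P := by
  rw [hC.integral_tupleCount t h, tupleMean, mul_left_comm, ← sum_sum_sum_const]
  refine Finset.sum_le_sum fun i _ => Finset.sum_le_sum fun J hJ =>
    Finset.sum_le_sum fun L hL => ?_
  have := hC.le_measureReal_counts_mem hn ht (insert i (J ∪ L)) (tupleSets c k B i J)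
    (fun l _ => tupleSets_subset hc hk hB i J l) (by rwa [tuple_card hJ hL])
    (by rwa [tuple_card hJ hL])
  rw [tuple_prod _ hJ hL, tuple_card hJ hL] at this
  simpa only [tuple_event hJ hL] using this

/-! ### The completing draw and Bonferroni bounds. -/

lemma othersIn_range_eq_zero {n : ℕ} {m : ℕ} {N : Fin n → ℕ} {i : Fin n} :
    othersIn N (Finset.range m) i = 0 ↔ ∀ l, l ≠ i → m ≤ N l := by
  simp [othersIn, Finset.card_eq_zero, Finset.filter_eq_empty_iff]

lemma othersIn_insert {n : ℕ} {m k : ℕ} (hk : m ≤ k) (N : Fin n → ℕ) (i : Fin n) :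
    othersIn N (insert k (Finset.range m)) i =
      othersIn N {k} i + othersIn N (Finset.range m) i := by
  unfold othersIn
  rw [← Finset.card_union_of_disjoint]
  · congr 1
    ext l
    simp only [Finset.mem_filter, Finset.mem_union, Finset.mem_insert, Finset.mem_singleton]
    tauto
  · refine Finset.disjoint_left.2 fun l h1 h2 => ?_
    simp only [Finset.mem_filter, Finset.mem_singleton, Finset.mem_range] at h1 h2
    omega

/-- If the last missing coupon is `c s = i`, then the collection is completed by it. -/
lemma total_kTons_eq {n m k s : ℕ} {c : ℕ → Fin n} (hm : 1 ≤ m) (hk : k ≠ m)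
    (hi : copies c s (c s) = m - 1) (ho : othersIn (copies c s) (Finset.range m) (c s) = 0) :
    total m c = s + 1 ∧ kTons m k c = othersIn (copies c s) {k} (c s) := by
  rw [othersIn_range_eq_zero] at ho
  have hself : copies c (s + 1) (c s) = m := by
    rw [copies_succ, if_pos rfl, hi]
    omega
  have hother : ∀ l, l ≠ c s → copies c (s + 1) l = copies c s l := by
    intro l hl
    rw [copies_succ, if_neg (Ne.symm hl), add_zero]
  have hT : total m c = s + 1 := by
    refine le_antisymm (Nat.sInf_le fun l => ?_) (le_csInf ⟨s + 1, fun l => ?_⟩ fun t ht => ?_)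
    · by_cases hl : l = c s
      · rw [hl, hself]
      · rw [hother l hl]
        exact ho l hl
    · by_cases hl : l = c s
      · rw [hl, hself]
      · rw [hother l hl]
        exact ho l hl
    -- At any time up to `s`, the type `c s` has at most `m - 1` copies.
    · by_contra hlt
      have h1 := copies_mono c (c s) (Nat.lt_succ_iff.1 (not_le.1 hlt))
      have h2 := ht (c s)
      simp only at h1
      omega
  refine ⟨hT, ?_⟩
  rw [kTons, hT, othersIn]
  congr 1
  ext l
  simp only [Finset.mem_filter, Finset.mem_univ, true_and, Finset.mem_erase, and_true,
    Finset.mem_singleton]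
  by_cases hl : l = c s
  · simp [hl, hself, hk.symm]
  · simp [hl, hother l hl]

/-- Bonferroni: the sum stops at the odd index `2 R + 1`, and for `w > 0` it equals `-(w - 1).choose
(2 R + 1)`. -/
lemma sum_alternating_choose_le (w R : ℕ) :
    ∑ r ∈ Finset.range (2 * R + 2), (-1 : ℝ) ^ r * (w.choose r : ℝ) ≤ if w = 0 then 1 else 0 := by
  cases w with
  | zero => simp [Finset.sum_range_succ']
  | succ w =>
    have h := Int.alternating_sum_range_choose_eq_choose (n := w) (m := 2 * R + 1)
    have h2 : ∑ r ∈ Finset.range (2 * R + 2), (-1 : ℝ) ^ r * ((w + 1).choose r : ℝ) =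
        (-1) ^ (2 * R + 1) * (w.choose (2 * R + 1) : ℝ) := by exact_mod_cast h
    rw [h2, Odd.neg_one_pow ⟨R, rfl⟩]
    simp

/-- Let `U` others have `k` copies and `V` others fewer than `m`. Then `U.choose j` times the
indicator of `U + V - j = 0` is the indicator of `U = j` and `V = 0`, since the binomial coefficient
vanishes for `U < j`. Inserting `k` into `Finset.range m` thus lets one alternating sum control both
conditions. -/
lemma le_kTons_eq_indicator {n : ℕ} {m k : ℕ} (hk : m ≤ k) (j R : ℕ) (c : ℕ) (N : Fin n → ℕ) :
    ∑ r ∈ Finset.range (2 * R + 2),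
        (-1 : ℝ) ^ r * tupleCount c k j r (insert k (Finset.range m)) N ≤
      ∑ i, if N i = c ∧ othersIn N (Finset.range m) i = 0 ∧ othersIn N {k} i = j then 1 else 0 := by
  simp only [tupleCount, Finset.mul_sum]
  rw [Finset.sum_comm]
  refine Finset.sum_le_sum fun i _ => ?_
  by_cases hi : N i = c
  · simp only [hi, if_true, true_and]
    rw [othersIn_insert hk]
    have h := sum_alternating_choose_le
      (othersIn N {k} i + othersIn N (Finset.range m) i - j) R
    calc _ = ((othersIn N {k} i).choose j : ℝ) * ∑ r ∈ Finset.range (2 * R + 2), (-1 : ℝ) ^ r *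
          ((othersIn N {k} i + othersIn N (Finset.range m) i - j).choose r : ℝ) := by
          rw [Finset.mul_sum]
          exact Finset.sum_congr rfl fun r _ => by ring
      _ ≤ ((othersIn N {k} i).choose j : ℝ) *
          (if othersIn N {k} i + othersIn N (Finset.range m) i - j = 0 then 1 else 0) := by gcongr
      _ ≤ _ := by
          rcases lt_trichotomy (othersIn N {k} i) j with h1 | h1 | h1
          · rw [Nat.choose_eq_zero_of_lt h1]
            simp only [Nat.cast_zero, zero_mul]
            split_ifs <;> norm_num
          · simp [h1]
          · rw [if_neg (by omega)]
            simp only [mul_zero]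
            split_ifs <;> norm_num
  · simp [hi]

/-- With `U` and `V` the numbers of other types with `k` and with fewer than `m` copies, the
indicator of `V = 0`, `U ≠ 0` is at least that of `V = 0` minus `((U - Λ) / Λ) ^ 2`, which equals
`1` at `U = 0`. The first term is treated by Bonferroni; the square is written in binomial moments.
In use, `Λ` is the approximate mean of `U`. -/
lemma le_kTons_ne_zero_indicator {n : ℕ} {m k : ℕ} {Λ : ℝ} (hΛ : 0 < Λ) (R : ℕ) (c : ℕ)
    (N : Fin n → ℕ) :
    ∑ r ∈ Finset.range (2 * R + 2), (-1 : ℝ) ^ r * tupleCount c k 0 r (Finset.range m) N -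
        (2 / Λ ^ 2 * tupleCount c k 0 2 {k} N + (1 / Λ ^ 2 - 2 / Λ) * tupleCount c k 0 1 {k} N +
          tupleCount c k 0 0 {k} N) ≤
      ∑ i, if N i = c ∧ othersIn N (Finset.range m) i = 0 ∧ othersIn N {k} i ≠ 0 then 1 else 0 := by
  simp only [tupleCount, Finset.mul_sum]
  rw [Finset.sum_comm, ← Finset.sum_add_distrib, ← Finset.sum_add_distrib,
    ← Finset.sum_sub_distrib]
  refine Finset.sum_le_sum fun i _ => ?_
  by_cases hi : N i = c
  · simp only [hi, if_true, true_and, Nat.choose_zero_right, Nat.cast_one, one_mul, Nat.sub_zero,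
      Nat.choose_one_right, mul_one]
    have h := sum_alternating_choose_le (othersIn N (Finset.range m) i) R
    have hsq : 2 / Λ ^ 2 * ((othersIn N {k} i).choose 2 : ℝ) +
        (1 / Λ ^ 2 - 2 / Λ) * (othersIn N {k} i : ℝ) + 1 =
        (((othersIn N {k} i : ℝ) - Λ) / Λ) ^ 2 := by
      rw [Nat.cast_choose_two]
      field_simp
      ring
    rw [hsq]
    by_cases hU : othersIn N {k} i = 0
    · have : ((((0 : ℕ) : ℝ) - Λ) / Λ) ^ 2 = 1 := by
        field_simp
        simp
      rw [hU, this]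
      simp only [ne_eq, not_true_eq_false, and_false, if_false]
      split_ifs at h <;> linarith
    · simp only [ne_eq, hU, not_false_eq_true, and_true]
      exact (sub_le_self _ (sq_nonneg _)).trans h
  · simp [hi]

variable {Ω : Type*} {n : ℕ} {C : ℕ → Ω → Fin n}

variable [MeasurableSpace Ω] {P : Measure Ω} [IsProbabilityMeasure P]

/-- The type completing the collection is `C s`, which equals a given `i` with probability `1 / n`
independently of the counts; this is the factor `n`. That type ends with exactly `m` copies, so for
`k ≠ m` the `k`-tons are found among the others. -/
theorem IsCouponSequence.integral_le_measureReal_total (hC : IsCouponSequence C P) (hn : n ≠ 0)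
    {m k : ℕ} (hm : 1 ≤ m) (hk : k ≠ m) (s : ℕ) (Q : ℕ → Prop) [DecidablePred Q]
    {f : (Fin n → ℕ) → ℝ} (hf : Integrable (fun ω => f (counts C s ω)) P)
    (hfQ : ∀ N, f N ≤ ∑ i, if N i = m - 1 ∧ othersIn N (Finset.range m) i = 0 ∧
      Q (othersIn N {k} i) then 1 else 0) :
    ∫ ω, f (counts C s ω) ∂P ≤
      n * P.real {ω | total m (fun t => C t ω) = s + 1 ∧ Q (kTons m k fun t => C t ω)} := by
  let A : Fin n → Set (Fin n → ℕ) := fun i => {N | N i = m - 1 ∧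
    othersIn N (Finset.range m) i = 0 ∧ Q (othersIn N {k} i)}
  have hn0 : (n : ℝ) ≠ 0 := by exact_mod_cast hn
  have h1 : ∫ ω, f (counts C s ω) ∂P ≤ ∑ i, P.real {ω | counts C s ω ∈ A i} := by
    have hI : ∀ i ∈ Finset.univ, Integrable (fun ω => if counts C s ω i = m - 1 ∧
        othersIn (counts C s ω) (Finset.range m) i = 0 ∧ Q (othersIn (counts C s ω) {k} i)
        then (1 : ℝ) else 0) P := fun i _ => hC.integrable_ite s fun N => N i = m - 1 ∧
          othersIn N (Finset.range m) i = 0 ∧ Q (othersIn N {k} i)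
    refine (integral_mono hf (integrable_finsetSum _ hI) fun ω => hfQ _).trans_eq ?_
    rw [integral_finsetSum _ hI]
    exact Finset.sum_congr rfl fun i _ => hC.integral_ite s fun N => N i = m - 1 ∧
          othersIn N (Finset.range m) i = 0 ∧ Q (othersIn N {k} i)
  have h2 : ∑ i, P.real {ω | counts C s ω ∈ A i} =
      n * P.real (⋃ i ∈ (Finset.univ : Finset (Fin n)),
        {ω | counts C s ω ∈ A i ∧ C s ω = i}) := by
    rw [measureReal_biUnion_finset, Finset.mul_sum]
    · refine Finset.sum_congr rfl fun i _ => ?_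
      rw [hC.measureReal_counts_inter]
      field_simp
    · intro i _ j _ hij
      exact Set.disjoint_left.2 fun ω h1 h2 => hij (h1.2.symm.trans h2.2)
    · intro i _
      exact (hC.measurableSet_counts s (A i)).inter (hC.measurable s (measurableSet_singleton i))
  rw [h2] at h1
  refine h1.trans ?_
  gcongr
  · exact measure_ne_top _ _
  refine Set.iUnion₂_subset fun i _ ω hω => ?_
  obtain ⟨⟨e1, e2, e3⟩, rfl⟩ := hω
  obtain ⟨h3, h4⟩ := total_kTons_eq (c := fun t => C t ω) hm hk e1 e2
  exact ⟨h3, by rw [h4]; exact e3⟩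

theorem IsCouponSequence.le_measureReal_kTons_eq (hC : IsCouponSequence C P) (hn : n ≠ 0)
    {m k : ℕ} (hm : 1 ≤ m) (hk : m < k) (s j R : ℕ) :
    ∑ r ∈ Finset.range (2 * R + 2), (-1 : ℝ) ^ r *
        ∫ ω, tupleCount (m - 1) k j r (insert k (Finset.range m)) (counts C s ω) ∂P ≤
      n * P.real {ω | total m (fun t => C t ω) = s + 1 ∧ kTons m k (fun t => C t ω) = j} := by
  have hI : ∀ r, Integrable (fun ω => (-1 : ℝ) ^ r *
      tupleCount (m - 1) k j r (insert k (Finset.range m)) (counts C s ω)) P := fun r =>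
    (hC.integrable_tupleCount s (Or.inl (Finset.mem_insert_self _ _))).const_mul _
  have := hC.integral_le_measureReal_total hn hm hk.ne' s (fun u => u = j)
    (integrable_finsetSum _ fun r _ => hI r) (le_kTons_eq_indicator hk.le j R (m - 1))
  rw [integral_finsetSum _ fun r _ => hI r] at this
  simpa only [integral_const_mul] using this

theorem IsCouponSequence.le_measureReal_kTons_ne_zero (hC : IsCouponSequence C P) (hn : n ≠ 0)
    {m k : ℕ} (hm : 1 ≤ m) (hk : m < k) {Λ : ℝ} (hΛ : 0 < Λ) (s R : ℕ) :
    ∑ r ∈ Finset.range (2 * R + 2), (-1 : ℝ) ^ r *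
        ∫ ω, tupleCount (m - 1) k 0 r (Finset.range m) (counts C s ω) ∂P -
      (2 / Λ ^ 2 * ∫ ω, tupleCount (m - 1) k 0 2 {k} (counts C s ω) ∂P +
        (1 / Λ ^ 2 - 2 / Λ) * ∫ ω, tupleCount (m - 1) k 0 1 {k} (counts C s ω) ∂P +
        ∫ ω, tupleCount (m - 1) k 0 0 {k} (counts C s ω) ∂P) ≤
      n * P.real {ω | total m (fun t => C t ω) = s + 1 ∧ kTons m k (fun t => C t ω) ≠ 0} := by
  have hI : ∀ r B, Integrable (fun ω => tupleCount (m - 1) k 0 r B (counts C s ω)) P :=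
    fun r B => hC.integrable_tupleCount s (Or.inr rfl)
  have hI1 : ∀ r ∈ Finset.range (2 * R + 2), Integrable (fun ω => (-1 : ℝ) ^ r *
      tupleCount (m - 1) k 0 r (Finset.range m) (counts C s ω)) P :=
    fun r _ => (hI r _).const_mul _
  have hI2 := ((hI 2 {k}).const_mul (2 / Λ ^ 2)).add
    ((hI 1 {k}).const_mul (1 / Λ ^ 2 - 2 / Λ))
  have := hC.integral_le_measureReal_total hn hm hk.ne' s (fun u => u ≠ 0)
    ((integrable_finsetSum _ hI1).sub (hI2.add (hI 0 {k})))
    (le_kTons_ne_zero_indicator hΛ R (m - 1))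
  refine le_trans (le_of_eq ?_) this
  refine Eq.trans ?_ (integral_sub (integrable_finsetSum _ hI1) (hI2.add (hI 0 {k}))).symm
  rw [integral_finsetSum _ hI1, integral_add' hI2 (hI 0 {k}),
    integral_add' ((hI 2 {k}).const_mul _) ((hI 1 {k}).const_mul _)]
  simp only [integral_const_mul]

/-! ### Asymptotics of Poisson weights, with `L` in the role of `log n`. -/

section Asymptotics

open Asymptotics

variable {ι : Type*} {l : Filter ι} {L τ δ : ι → ℝ} {c : ℕ} {x : ℝ}

lemma isLittleO_log_self_comp (hL : Tendsto L l atTop) :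
    (fun i => Real.log (L i)) =o[l] L :=
  Real.isLittleO_log_id_atTop.comp_tendsto hL

/-- `L + c log L + O(1)` is asymptotic to `L`. -/
lemma tendsto_div_of_sub_tendsto (hL : Tendsto L l atTop)
    (hτ : Tendsto (fun i => τ i - (L i + c * Real.log (L i))) l (𝓝 x)) :
    Tendsto (fun i => τ i / L i) l (𝓝 1) := by
  have h1 : Tendsto (fun i => Real.log (L i) / L i) l (𝓝 0) :=
    (isLittleO_log_self_comp hL).tendsto_div_nhds_zero
  have h2 := (hτ.div_atTop hL).add ((h1.const_mul (c : ℝ)).const_add 1)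
  simp only [mul_zero, add_zero, zero_add] at h2
  refine h2.congr' ?_
  filter_upwards [hL.eventually_gt_atTop 0] with i hi
  field_simp
  ring

lemma exp_mul_poissonWeight_eq {L τ : ℝ} (hL : 0 < L) (b c : ℕ) :
    Real.exp L * poissonWeight τ b =
      Real.exp (-(τ - (L + c * Real.log L))) * (τ / L) ^ b * (L ^ b / L ^ c) / b ! := by
  have h1 : Real.exp (-(τ - (L + c * Real.log L))) = Real.exp L * Real.exp (-τ) * L ^ c := by
    rw [← Real.exp_log (pow_pos hL c), Real.log_pow, ← Real.exp_add, ← Real.exp_add]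
    congr 1
    ring
  rw [h1, poissonWeight, div_pow]
  field_simp

/-- Since `exp (L - τ)` is about `exp (-x) / L ^ c` and `τ ^ b` about `L ^ b`, only `b = c`
survives. -/
lemma tendsto_exp_mul_poissonWeight (hL : Tendsto L l atTop)
    (hτ : Tendsto (fun i => τ i - (L i + c * Real.log (L i))) l (𝓝 x)) {b : ℕ} (hb : b ≤ c) :
    Tendsto (fun i => Real.exp (L i) * poissonWeight (τ i) b) l
      (𝓝 (if b = c then Real.exp (-x) / c ! else 0)) := by
  have h1 : Tendsto (fun i => L i ^ b / L i ^ c) l (𝓝 (if b = c then 1 else 0)) := by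
    split_ifs with h
    · subst h
      refine tendsto_const_nhds.congr' ?_
      filter_upwards [hL.eventually_gt_atTop 0] with i hi
      field_simp
    · exact (tendsto_pow_div_pow_atTop_zero (lt_of_le_of_ne hb h)).comp hL
  have h2 := ((((Real.continuous_exp.tendsto _).comp hτ.neg).mul
    ((tendsto_div_of_sub_tendsto hL hτ).pow b)).mul h1).div_const (b ! : ℝ)
  have h3 : Real.exp (-x) * 1 ^ b * (if b = c then 1 else 0) / (b ! : ℝ) =
      if b = c then Real.exp (-x) / c ! else 0 := by
    split_ifs with h <;> simp [h]
  rw [h3] at h2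
  refine h2.congr' ?_
  filter_upwards [hL.eventually_gt_atTop 0] with i hi
  rw [exp_mul_poissonWeight_eq hi b c]
  rfl

lemma tendsto_exp_mul_poissonMass_range (hL : Tendsto L l atTop)
    (hτ : Tendsto (fun i => τ i - (L i + c * Real.log (L i))) l (𝓝 x)) :
    Tendsto (fun i => Real.exp (L i) * poissonMass (τ i) (Finset.range (c + 1))) l
      (𝓝 (Real.exp (-x) / c !)) := by
  simp only [poissonMass, Finset.mul_sum]
  have h := tendsto_finsetSum (Finset.range (c + 1)) fun b hb =>
    tendsto_exp_mul_poissonWeight hL hτ (Nat.lt_succ_iff.1 (Finset.mem_range.1 hb))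
  simpa using h

/-- `k log (k / (e τ)) = k - e τ + o(1)` in quantitative form. -/
lemma mul_log_div_sub_mem_Icc {κ T : ℝ} (hκ : 0 < κ) (hT : 0 < T) :
    κ * Real.log (κ / T) - (κ - T) ∈ Set.Icc 0 ((κ - T) ^ 2 / T) := by
  have hy : 0 < κ / T := div_pos hκ hT
  constructor
  · have h := Real.one_sub_inv_le_log_of_pos hy
    have h2 : κ * (1 - (κ / T)⁻¹) = κ - T := by field_simp
    nlinarith [mul_le_mul_of_nonneg_left h hκ.le]
  · have h := Real.log_le_sub_one_of_pos hy
    have h2 : κ * (κ / T - 1) - (κ - T) = (κ - T) ^ 2 / T := by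
      field_simp
    linarith [mul_le_mul_of_nonneg_left h hκ.le]

variable {k : ι → ℕ}

/-- `k = e L + O(log L)` is asymptotic to `e L`. -/
lemma tendsto_div_exp_one (hL : Tendsto L l atTop) {β : ℝ}
    (hk : ∀ᶠ i in l, (k i : ℝ) = Real.exp 1 * L i + β * Real.log (L i) + δ i)
    (hδ : δ =o[l] fun i => Real.log (L i)) :
    Tendsto (fun i => (k i : ℝ) / L i) l (𝓝 (Real.exp 1)) := by
  have h1 : Tendsto (fun i => Real.log (L i) / L i) l (𝓝 0) :=
    (isLittleO_log_self_comp hL).tendsto_div_nhds_zero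
  have h2 : Tendsto (fun i => δ i / L i) l (𝓝 0) :=
    (hδ.trans (isLittleO_log_self_comp hL)).tendsto_div_nhds_zero
  have h3 := ((h1.const_mul β).add h2).const_add (Real.exp 1)
  simp only [mul_zero, add_zero] at h3
  refine h3.congr' ?_
  filter_upwards [hL.eventually_gt_atTop 0, hk] with i hi hki
  rw [hki]
  field_simp
  ring

/-- Stirling's formula, with the discrepancy `k log (k / (e τ)) - (k - e τ)` made explicit. -/
lemma exp_mul_poissonWeight_mul_exp_eq {L τ δ : ℝ} {k : ℕ} (hL : 0 < L) (hτ : 0 < τ) (hk : k ≠ 0)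
    (hkL : (k : ℝ) =
      Real.exp 1 * L + ((Real.exp 1 - 1) * c - 1 / 2) * Real.log L + δ) :
    Real.exp L * poissonWeight τ k * Real.exp δ =
      Real.exp ((Real.exp 1 - 1) * (τ - (L + c * Real.log L))) *
        Real.exp (-(k * Real.log (k / (Real.exp 1 * τ)) - (k - Real.exp 1 * τ))) /
        (√2 * √(k / L) * Stirling.stirlingSeq k) := by
  have hk0 : (0 : ℝ) < k := by exact_mod_cast Nat.pos_of_ne_zero hk
  have hS : (k ! : ℝ) = Stirling.stirlingSeq k * (√(2 * k) * (k / Real.exp 1) ^ k) := by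
    rw [Stirling.stirlingSeq]
    field_simp
  have hS0 : Stirling.stirlingSeq k ≠ 0 := by
    unfold Stirling.stirlingSeq
    positivity
  have hpow : τ ^ k / (k / Real.exp 1) ^ k =
      Real.exp (-(k * Real.log (k / (Real.exp 1 * τ)))) := by
    rw [← div_pow, ← Real.exp_log (pow_pos (by positivity : 0 < τ / (k / Real.exp 1)) k),
      Real.log_pow, ← mul_neg, ← Real.log_inv]
    congr 3
    field_simp
  have hsqrt : √(2 * k) = √2 * √(k / L) * Real.exp (Real.log L / 2) := by
    have : Real.exp (Real.log L / 2) = √L := by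
      rw [← Real.log_sqrt hL.le, Real.exp_log (Real.sqrt_pos.2 hL)]
    rw [this, mul_assoc, ← Real.sqrt_mul (by positivity), ← Real.sqrt_mul (by norm_num)]
    congr 2
    field_simp
  calc Real.exp L * poissonWeight τ k * Real.exp δ
      = Real.exp L * Real.exp (-τ) * (τ ^ k / (k / Real.exp 1) ^ k) * Real.exp δ /
          (√(2 * k) * Stirling.stirlingSeq k) := by
        rw [poissonWeight, hS]
        field_simp
    _ = (Real.exp L * Real.exp (-τ) * Real.exp (-(k * Real.log (k / (Real.exp 1 * τ)))) *
          Real.exp δ * Real.exp (-(Real.log L / 2))) /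
          (√2 * √(k / L) * Stirling.stirlingSeq k) := by
        rw [hpow, hsqrt, Real.exp_neg (Real.log L / 2)]
        field_simp
    _ = _ := by
        simp only [← Real.exp_add]
        congr 2
        -- Comparing exponents leaves exactly the equation defining `k`; the term `-1/2` in the
        -- centring absorbs the `√L` from Stirling's formula.
        linear_combination -hkL

/-- The factor `exp δ` normalizes the weight, so that bounded and diverging offsets are treated
together. -/
lemma tendsto_exp_mul_poissonWeight_mul_exp (hL : Tendsto L l atTop)
    (hτ : Tendsto (fun i => τ i - (L i + c * Real.log (L i))) l (𝓝 x))
    (hk : ∀ᶠ i in l, (k i : ℝ) =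
      Real.exp 1 * L i + ((Real.exp 1 - 1) * c - 1 / 2) * Real.log (L i) + δ i)
    (hδ : δ =o[l] fun i => Real.log (L i)) :
    Tendsto (fun i => Real.exp (L i) * poissonWeight (τ i) (k i) * Real.exp (δ i)) l
      (𝓝 (Real.exp ((Real.exp 1 - 1) * x) / √(2 * Real.pi * Real.exp 1))) := by
  have hτL := tendsto_div_of_sub_tendsto hL hτ
  have hkL := tendsto_div_exp_one hL hk hδ
  have hτ0 : ∀ᶠ i in l, 0 < τ i := by
    filter_upwards [hτL.eventually (lt_mem_nhds one_pos), hL.eventually_gt_atTop 0] with i h1 h2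
    have := mul_pos h1 h2
    rwa [div_mul_cancel₀ _ h2.ne'] at this
  have hktop : Tendsto k l atTop := by
    rw [← tendsto_natCast_atTop_iff (R := ℝ)]
    refine (hkL.pos_mul_atTop (Real.exp_pos 1) hL).congr' ?_
    filter_upwards [hL.eventually_gt_atTop 0] with i hi
    field_simp
  have hdiff : (fun i => (k i : ℝ) - Real.exp 1 * τ i) =O[l] fun i => Real.log (L i) := by
    have h1 : (fun i => ((Real.exp 1 - 1) * c - 1 / 2 - Real.exp 1 * c) * Real.log (L i) +
        δ i - Real.exp 1 * (τ i - (L i + c * Real.log (L i)))) =O[l]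
        fun i => Real.log (L i) := by
      refine ((isBigO_const_mul_self _ _ _).add hδ.isBigO).sub ?_
      refine ((hτ.const_mul _).isBigO_one ℝ).trans ?_
      exact (isLittleO_const_left.2 (Or.inr
        (tendsto_norm_atTop_atTop.comp (Real.tendsto_log_atTop.comp hL)))).isBigO
    refine h1.congr' ?_ EventuallyEq.rfl
    filter_upwards [hk] with i hi
    rw [hi]
    ring
  -- As `k - e τ = O(log L)`, its square is negligible against `τ ~ L`.
  have hsq : Tendsto (fun i => ((k i : ℝ) - Real.exp 1 * τ i) ^ 2 / (Real.exp 1 * τ i)) l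
      (𝓝 0) := by
    have h1 : (fun i => ((k i : ℝ) - Real.exp 1 * τ i) ^ 2) =o[l] L :=
      (hdiff.pow 2).trans_isLittleO
        ((Real.isLittleO_pow_log_id_atTop (n := 2)).comp_tendsto hL)
    have h2 := h1.tendsto_div_nhds_zero.div (hτL.const_mul (Real.exp 1))
      (by simp)
    rw [zero_div] at h2
    refine h2.congr' ?_
    filter_upwards [hL.eventually_gt_atTop 0, hτ0] with i h1 h2
    simp only [Pi.div_apply]
    field_simp
  have herr : Tendsto (fun i => (k i : ℝ) * Real.log (k i / (Real.exp 1 * τ i)) -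
      (k i - Real.exp 1 * τ i)) l (𝓝 0) := by
    refine tendsto_of_tendsto_of_tendsto_of_le_of_le' tendsto_const_nhds hsq ?_ ?_
    · filter_upwards [hτ0, hktop.eventually_gt_atTop 0] with i h1 h2
      exact (mul_log_div_sub_mem_Icc (by exact_mod_cast h2) (by positivity)).1
    · filter_upwards [hτ0, hktop.eventually_gt_atTop 0] with i h1 h2
      exact (mul_log_div_sub_mem_Icc (by exact_mod_cast h2) (by positivity)).2
  have hlim := (((Real.continuous_exp.tendsto _).comp (hτ.const_mul (Real.exp 1 - 1))).mul
    ((Real.continuous_exp.tendsto _).comp herr.neg)).div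
    (((Real.continuous_sqrt.tendsto _).comp hkL).const_mul (√2) |>.mul
      (Stirling.tendsto_stirlingSeq_sqrt_pi.comp hktop)) (by positivity)
  have hval : Real.exp ((Real.exp 1 - 1) * x) * Real.exp (-0) /
      (√2 * √(Real.exp 1) * √Real.pi) =
      Real.exp ((Real.exp 1 - 1) * x) / √(2 * Real.pi * Real.exp 1) := by
    rw [neg_zero, Real.exp_zero, mul_one, Real.sqrt_mul (by positivity), Real.sqrt_mul (by simp)]
    congr 1
    ring
  rw [hval] at hlim
  refine hlim.congr' ?_
  filter_upwards [hL.eventually_gt_atTop 0, hτ0, hktop.eventually_gt_atTop 0, hk] with i h1 h2 h3 h4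
  exact (exp_mul_poissonWeight_mul_exp_eq h1 h2 h3.ne' h4).symm

end Asymptotics

/-! ### Local limit bounds. -/

section LocalLimit

open Asymptotics

lemma tendsto_choose_sub_div_pow (a j : ℕ) :
    Tendsto (fun N : ℕ => ((N - a).choose j : ℝ) / (N : ℝ) ^ j) atTop (𝓝 (1 / j !)) := by
  have hsub : Tendsto (fun N : ℕ => N - a) atTop atTop := tendsto_sub_atTop_nat a
  have h1 : Tendsto (fun N : ℕ => (N.choose j : ℝ) / (N : ℝ) ^ j) atTop (𝓝 (1 / j !)) := by
    have h := (isEquivalent_iff_tendsto_one (by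
      filter_upwards [eventually_gt_atTop 0] with N hN
      positivity)).1 (isEquivalent_choose j)
    refine (h.div_const (j ! : ℝ)).congr' ?_
    filter_upwards [eventually_gt_atTop 0] with N hN
    simp only [Pi.div_apply]
    field_simp
  have h2 : Tendsto (fun N : ℕ => ((N - a : ℕ) : ℝ) / N) atTop (𝓝 1) := by
    have h := (tendsto_const_div_atTop_nhds_zero_nat (a : ℝ)).const_sub 1
    rw [sub_zero] at h
    refine h.congr' ?_
    filter_upwards [eventually_gt_atTop a] with N hN
    rw [Nat.cast_sub hN.le]
    have : (N : ℝ) ≠ 0 := by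
      have : N ≠ 0 := by omega
      exact_mod_cast this
    field_simp
  have h3 := (h1.comp hsub).mul (h2.pow j)
  rw [one_pow, mul_one] at h3
  refine h3.congr' ?_
  filter_upwards [eventually_gt_atTop a] with N hN
  have h4 : ((N - a : ℕ) : ℝ) ≠ 0 := by
    have : N - a ≠ 0 := by omega
    exact_mod_cast this
  simp only [Function.comp_apply, div_pow]
  field_simp

variable {ι : Type*} {l : Filter ι} {n s k : ι → ℕ} {e : ℝ}

lemma tendsto_log_div_self (hn : Tendsto n l atTop) :
    Tendsto (fun i => Real.log (n i) / n i) l (𝓝 0) :=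
  (Real.isLittleO_log_id_atTop.tendsto_div_nhds_zero).comp
    (tendsto_natCast_atTop_atTop.comp hn)

lemma tendsto_log_natCast (hn : Tendsto n l atTop) :
    Tendsto (fun i => Real.log (n i)) l atTop :=
  Real.tendsto_log_atTop.comp (tendsto_natCast_atTop_atTop.comp hn)

lemma eventually_log_pos (hn : Tendsto n l atTop) :
    ∀ᶠ i in l, 0 < Real.log (n i) ∧ 0 < (n i : ℝ) := by
  filter_upwards [(tendsto_log_natCast hn).eventually_gt_atTop 0, hn.eventually_gt_atTop 0]
    with i h1 h2
  exact ⟨h1, by exact_mod_cast h2⟩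

lemma tendsto_sq_div (hn : Tendsto n l atTop)
    (hτ : Tendsto (fun i => (s i : ℝ) / n i / Real.log (n i)) l (𝓝 1))
    (hk : Tendsto (fun i => (k i : ℝ) / Real.log (n i)) l (𝓝 e)) (r : ℕ) :
    Tendsto (fun i => (r * k i : ℝ) ^ 2 / s i) l (𝓝 0) := by
  have h := ((hk.pow 2).mul (tendsto_log_div_self hn)).div hτ one_ne_zero |>.const_mul ((r : ℝ) ^ 2)
  simp only [mul_zero, zero_div] at h
  refine h.congr' ?_
  filter_upwards [eventually_log_pos hn] with i hi
  obtain ⟨h1, h2⟩ := hi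
  simp only [Pi.div_apply]
  rcases eq_or_ne (s i) 0 with h0 | h0
  · simp [h0]
  · have : (s i : ℝ) ≠ 0 := by exact_mod_cast h0
    field_simp

lemma tendsto_mul_div_sq (hn : Tendsto n l atTop)
    (hτ : Tendsto (fun i => (s i : ℝ) / n i / Real.log (n i)) l (𝓝 1)) (r : ℕ) :
    Tendsto (fun i => (r : ℝ) ^ 2 * s i / (n i : ℝ) ^ 2) l (𝓝 0) := by
  have h := (hτ.mul (tendsto_log_div_self hn)).const_mul ((r : ℝ) ^ 2)
  simp only [mul_zero] at h
  refine h.congr' ?_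
  filter_upwards [eventually_log_pos hn] with i hi
  obtain ⟨h1, h2⟩ := hi
  field_simp

lemma tendsto_lowerFactor (hn : Tendsto n l atTop)
    (hτ : Tendsto (fun i => (s i : ℝ) / n i / Real.log (n i)) l (𝓝 1))
    (hk : Tendsto (fun i => (k i : ℝ) / Real.log (n i)) l (𝓝 e)) (r : ℕ) :
    Tendsto (fun i => lowerFactor (n i) (s i) (k i) r) l (𝓝 1) := by
  simpa [lowerFactor] using
    ((tendsto_sq_div hn hτ hk r).const_sub 1).mul ((tendsto_mul_div_sq hn hτ r).const_sub 1)

lemma tendsto_upperFactor (hn : Tendsto n l atTop)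
    (hk : Tendsto (fun i => (k i : ℝ) / Real.log (n i)) l (𝓝 e)) (r : ℕ) :
    Tendsto (fun i => upperFactor (n i) (k i) r) l (𝓝 1) := by
  have h := (hk.mul (tendsto_log_div_self hn)).const_mul ((r : ℝ) ^ 2)
  simp only [mul_zero] at h
  have h2 := (Real.continuous_exp.tendsto _).comp h
  rw [Real.exp_zero] at h2
  refine h2.congr' ?_
  filter_upwards [eventually_log_pos hn] with i hi
  obtain ⟨h1, h2⟩ := hi
  simp only [upperFactor, Function.comp_apply]
  congr 1
  field_simp

lemma eventually_le_of_tendsto_div {u v : ι → ℕ}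
    (h : Tendsto (fun i => (u i : ℝ) / v i) l (𝓝 0)) (hv : ∀ᶠ i in l, v i ≠ 0) :
    ∀ᶠ i in l, u i ≤ v i := by
  filter_upwards [h.eventually (gt_mem_nhds one_pos), hv] with i h1 h2
  have h3 : (0 : ℝ) < v i := by exact_mod_cast Nat.pos_of_ne_zero h2
  rw [div_lt_one h3] at h1
  exact_mod_cast h1.le

variable {Ω : ι → Type*} [∀ i, MeasurableSpace (Ω i)] {P : ∀ i, Measure (Ω i)}
  [∀ i, IsProbabilityMeasure (P i)] {C : ∀ i, ℕ → Ω i → Fin (n i)}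

/-- The weight `w` is `1` for convergent moments and an inverse power of the mean for diverging
ones. -/
theorem tendsto_integral_tupleCount (hC : ∀ i, IsCouponSequence (C i) (P i))
    (hn : Tendsto n l atTop)
    (hτ : Tendsto (fun i => (s i : ℝ) / n i / Real.log (n i)) l (𝓝 1))
    (hk : Tendsto (fun i => (k i : ℝ) / Real.log (n i)) l (𝓝 e))
    {c j r : ℕ} {B : ι → Finset ℕ} (hc : ∀ᶠ i in l, c ≤ k i) (hB : ∀ i, k i ∈ B i ∨ j = 0)
    (hBk : ∀ᶠ i in l, B i ⊆ Finset.range (k i + 1)) {w : ι → ℝ} (hw : ∀ i, 0 ≤ w i) {v : ℝ}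
    (hv : Tendsto (fun i => w i * tupleMean (n i) (s i / n i) c (k i) j r (B i)) l (𝓝 v)) :
    Tendsto (fun i => w i * ∫ ω, tupleCount c (k i) j r (B i) (counts (C i) (s i) ω) ∂P i) l
      (𝓝 v) := by
  have hlow := (tendsto_lowerFactor hn hτ hk (1 + j + r)).mul hv
  have hup := (tendsto_upperFactor hn hk (1 + j + r)).mul hv
  rw [one_mul] at hlow hup
  have hn0 : ∀ᶠ i in l, n i ≠ 0 := by
    filter_upwards [hn.eventually_gt_atTop 0] with i hi using hi.ne'
  have hs0 : ∀ᶠ i in l, s i ≠ 0 := by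
    filter_upwards [hτ.eventually (lt_mem_nhds one_pos)] with i hi h0
    simp [h0] at hi
  have hK : ∀ᶠ i in l, ((1 + j + r) * k i) ^ 2 ≤ s i := eventually_le_of_tendsto_div (by
    simpa using tendsto_sq_div hn hτ hk (1 + j + r)) hs0
  have hr : ∀ᶠ i in l, (1 + j + r) ^ 2 * s i ≤ n i ^ 2 := eventually_le_of_tendsto_div (by
    simpa using tendsto_mul_div_sq hn hτ (1 + j + r)) (hn0.mono fun i hi => pow_ne_zero 2 hi)
  refine tendsto_of_tendsto_of_tendsto_of_le_of_le' hlow hup ?_ ?_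
  · filter_upwards [hn0, hs0, hK, hr, hc, hBk] with i h1 h2 h3 h4 h5 h6
    rw [mul_left_comm]
    exact mul_le_mul_of_nonneg_left
      ((hC i).le_integral_tupleCount h1 h2 (hB i) h5 le_rfl h6 h3 h4) (hw i)
  · filter_upwards [hn0, hc, hBk] with i h1 h5 h6
    rw [mul_left_comm]
    exact mul_le_mul_of_nonneg_left
      ((hC i).integral_tupleCount_le h1 (s i) (hB i) h5 le_rfl h6) (hw i)

lemma tendsto_tupleMean (hn : Tendsto n l atTop) {τ : ι → ℝ} {c j r : ℕ} {B : ι → Finset ℕ}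
    {w : ι → ℝ} {a y : ℝ} (ha : Tendsto (fun i => n i * poissonWeight (τ i) c) l (𝓝 a))
    (hy : Tendsto (fun i => w i * ((n i * poissonWeight (τ i) (k i)) ^ j *
      (n i * poissonMass (τ i) (B i)) ^ r)) l (𝓝 y)) :
    Tendsto (fun i => w i * tupleMean (n i) (τ i) c (k i) j r (B i)) l
      (𝓝 (a * y / (j ! * r !))) := by
  have h := (((tendsto_choose_sub_div_pow 1 j).comp hn).mul
    ((tendsto_choose_sub_div_pow (1 + j) r).comp hn)).mul (ha.mul hy)
  have hval : 1 / (j ! : ℝ) * (1 / r !) * (a * y) = a * y / (j ! * r !) := by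
    field_simp
  rw [hval] at h
  refine h.congr' ?_
  filter_upwards [hn.eventually_gt_atTop 0] with i hi
  have : (n i : ℝ) ≠ 0 := by exact_mod_cast hi.ne'
  simp only [Function.comp_apply, tupleMean, mul_pow, Nat.sub_add_eq]
  field_simp

lemma tendsto_sum_alternating (a : ℝ) :
    Tendsto (fun R : ℕ => ∑ r ∈ Finset.range (2 * R + 2), (-1 : ℝ) ^ r * (a ^ r / r !)) atTop
      (𝓝 (Real.exp (-a))) := by
  have h := (NormedSpace.expSeries_div_hasSum_exp (-a)).tendsto_sum_nat
  rw [← Real.exp_eq_exp_ℝ] at h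
  have h2 : Tendsto (fun R : ℕ => 2 * R + 2) atTop atTop :=
    tendsto_atTop_mono (fun R => by simp only [id]; omega) tendsto_id
  refine (h.comp h2).congr fun R => Finset.sum_congr rfl fun r _ => ?_
  rw [neg_pow, mul_div_assoc]

lemma ofReal_le_liminf_of_forall_lt {f : ι → ℝ≥0∞} {g : ι → ℝ} {v : ℝ}
    (hfg : ∀ i, f i = ENNReal.ofReal (g i)) (h : ∀ y < v, ∀ᶠ i in l, y ≤ g i) :
    ENNReal.ofReal v ≤ liminf f l := by
  refine le_of_forall_lt fun z hz => ?_
  have hz' := (ENNReal.lt_ofReal_iff_toReal_lt hz.ne_top).1 hz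
  obtain ⟨y, hy1, hy2⟩ := exists_between hz'
  refine lt_of_lt_of_le ((ENNReal.lt_ofReal_iff_toReal_lt hz.ne_top).2 hy1) ?_
  refine le_liminf_of_le (by isBoundedDefault) ?_
  filter_upwards [h y hy2] with i hi
  rw [hfg]
  exact ENNReal.ofReal_le_ofReal hi

/-- Used with the Bonferroni level `R` fixed while the index tends along `l`; `R` is sent to
infinity only afterwards. -/
lemma ofReal_le_liminf_of_tendsto {f : ι → ℝ≥0∞} {g : ι → ℝ} {G : ℕ → ι → ℝ} {u : ℕ → ℝ} {v : ℝ}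
    (hfg : ∀ i, f i = ENNReal.ofReal (g i)) (hG : ∀ R, ∀ᶠ i in l, G R i ≤ g i)
    (hGu : ∀ R, Tendsto (G R) l (𝓝 (u R))) (hu : Tendsto u atTop (𝓝 v)) :
    ENNReal.ofReal v ≤ liminf f l := by
  refine ofReal_le_liminf_of_forall_lt hfg fun y hy => ?_
  obtain ⟨R, hR⟩ := (hu.eventually (lt_mem_nhds hy)).exists
  filter_upwards [(hGu R).eventually (lt_mem_nhds hR), hG R] with i h1 h2 using h1.le.trans h2

lemma natCast_mul_measure_eq {α : Type*} [MeasurableSpace α] (μ : Measure α) [IsFiniteMeasure μ]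
    (n : ℕ) (S : Set α) : (n : ℝ≥0∞) * μ S = ENNReal.ofReal (n * μ.real S) := by
  rw [ENNReal.ofReal_mul (Nat.cast_nonneg n), ENNReal.ofReal_natCast, ofReal_measureReal]

variable {m : ℕ} {x : ℝ}

lemma tendsto_natCast_mul_poissonWeight_pred (hm : 1 ≤ m) (hn : Tendsto n l atTop)
    (hx : Tendsto (fun i => (s i : ℝ) / n i -
      (Real.log (n i) + (m - 1 : ℕ) * Real.log (Real.log (n i)))) l (𝓝 x)) :
    Tendsto (fun i => n i * poissonWeight (s i / n i) (m - 1)) l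
        (𝓝 (Real.exp (-x) / (m - 1)!)) ∧
      Tendsto (fun i => n i * poissonMass (s i / n i) (Finset.range m)) l
        (𝓝 (Real.exp (-x) / (m - 1)!)) := by
  have h1 := tendsto_exp_mul_poissonWeight (tendsto_log_natCast hn) hx le_rfl
  have h2 := tendsto_exp_mul_poissonMass_range (tendsto_log_natCast hn) hx
  rw [if_pos rfl] at h1
  rw [Nat.sub_add_cancel hm] at h2
  have hexp : ∀ᶠ i in l, Real.exp (Real.log (n i)) = n i := by
    filter_upwards [eventually_log_pos hn] with i hi using Real.exp_log hi.2
  constructor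
  · refine h1.congr' ?_
    filter_upwards [hexp] with i hi
    rw [hi]
  · refine h2.congr' ?_
    filter_upwards [hexp] with i hi
    rw [hi]

lemma eventually_lt_of_tendsto_div_log (hn : Tendsto n l atTop)
    (hk : Tendsto (fun i => (k i : ℝ) / Real.log (n i)) l (𝓝 (Real.exp 1))) (m : ℕ) :
    ∀ᶠ i in l, m < k i := by
  have h := hk.pos_mul_atTop (Real.exp_pos 1) (tendsto_log_natCast hn)
  filter_upwards [h.eventually_gt_atTop (m : ℝ), eventually_log_pos hn] with i h1 h2
  rw [div_mul_cancel₀ _ h2.1.ne'] at h1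
  exact_mod_cast h1

/-- The local lower bound for the joint law of the total and the number of `k`-tons. -/
theorem le_liminf_kTons_eq (hm : 1 ≤ m) (hC : ∀ i, IsCouponSequence (C i) (P i))
    (hn : Tendsto n l atTop) (hn0 : ∀ i, n i ≠ 0)
    (hx : Tendsto (fun i => (s i : ℝ) / n i -
      (Real.log (n i) + (m - 1 : ℕ) * Real.log (Real.log (n i)))) l (𝓝 x))
    (hk : Tendsto (fun i => (k i : ℝ) / Real.log (n i)) l (𝓝 (Real.exp 1))) {q : ℝ}
    (hq : Tendsto (fun i => n i * poissonWeight (s i / n i) (k i)) l (𝓝 q)) (j : ℕ) :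
    ENNReal.ofReal (Real.exp (-x) / (m - 1)! * (q ^ j / j !) *
        Real.exp (-(Real.exp (-x) / (m - 1)! + q))) ≤
      liminf (fun i => (n i : ℝ≥0∞) * P i {ω | total m (fun t => C i t ω) = s i + 1 ∧
        kTons m (k i) (fun t => C i t ω) = j}) l := by
  set a : ℝ := Real.exp (-x) / (m - 1)! with ha_def
  obtain ⟨ha, hB⟩ := tendsto_natCast_mul_poissonWeight_pred hm hn hx
  have hτ := tendsto_div_of_sub_tendsto (tendsto_log_natCast hn) hx
  have hmk := eventually_lt_of_tendsto_div_log hn hk m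
  have hmass : Tendsto (fun i => n i * poissonMass (s i / n i) (insert (k i) (Finset.range m))) l
      (𝓝 (a + q)) := by
    rw [add_comm a]
    refine (hq.add hB).congr' ?_
    filter_upwards [hmk] with i hi
    simp only [poissonMass]
    rw [Finset.sum_insert (by simpa using hi.le), mul_add]
  have hterm : ∀ r, Tendsto (fun i => ∫ ω, tupleCount (m - 1) (k i) j r
      (insert (k i) (Finset.range m)) (counts (C i) (s i) ω) ∂P i) l
      (𝓝 (a * (q ^ j * (a + q) ^ r) / (j ! * r !))) := by
    intro r
    have h := tendsto_integral_tupleCount (w := fun _ => 1)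
      (B := fun i => insert (k i) (Finset.range m)) hC hn hτ hk
      (hmk.mono fun i hi => (Nat.sub_le _ _).trans hi.le)
      (fun i => Or.inl (Finset.mem_insert_self _ _))
      (hmk.mono fun i hi => by
        intro b hb
        simp only [Finset.mem_insert, Finset.mem_range] at hb ⊢
        omega) (fun _ => zero_le_one)
      (tendsto_tupleMean (w := fun _ => 1) (j := j) (r := r) hn ha (by
        simpa using (hq.pow j).mul (hmass.pow r)))
    simpa using h
  refine ofReal_le_liminf_of_tendsto (fun i => natCast_mul_measure_eq _ _ _)
    (G := fun R i => ∑ r ∈ Finset.range (2 * R + 2), (-1 : ℝ) ^ r *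
      ∫ ω, tupleCount (m - 1) (k i) j r (insert (k i) (Finset.range m))
        (counts (C i) (s i) ω) ∂P i) (fun R => ?_)
    (fun R => tendsto_finsetSum _ fun r _ => (hterm r).const_mul _) ?_
  · filter_upwards [hmk] with i hi
    exact (hC i).le_measureReal_kTons_eq (hn0 i) hm hi (s i) j R
  · refine ((tendsto_sum_alternating (a + q)).const_mul (a * (q ^ j / j !))).congr fun R => ?_
    rw [Finset.mul_sum]
    refine Finset.sum_congr rfl fun r _ => ?_
    field_simp

/-- The local lower bound for the law of the total on the event that there are `k`-tons, if their
expected number tends to infinity. -/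
theorem le_liminf_kTons_ne_zero (hm : 1 ≤ m) (hC : ∀ i, IsCouponSequence (C i) (P i))
    (hn : Tendsto n l atTop) (hn0 : ∀ i, n i ≠ 0)
    (hx : Tendsto (fun i => (s i : ℝ) / n i -
      (Real.log (n i) + (m - 1 : ℕ) * Real.log (Real.log (n i)))) l (𝓝 x))
    (hk : Tendsto (fun i => (k i : ℝ) / Real.log (n i)) l (𝓝 (Real.exp 1)))
    (hq : Tendsto (fun i => n i * poissonWeight (s i / n i) (k i)) l atTop) :
    ENNReal.ofReal (Real.exp (-x) / (m - 1)! * Real.exp (-(Real.exp (-x) / (m - 1)!))) ≤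
      liminf (fun i => (n i : ℝ≥0∞) * P i {ω | total m (fun t => C i t ω) = s i + 1 ∧
        kTons m (k i) (fun t => C i t ω) ≠ 0}) l := by
  set a : ℝ := Real.exp (-x) / (m - 1)! with ha_def
  obtain ⟨ha, hB⟩ := tendsto_natCast_mul_poissonWeight_pred hm hn hx
  have hτ := tendsto_div_of_sub_tendsto (tendsto_log_natCast hn) hx
  have hmk := eventually_lt_of_tendsto_div_log hn hk m
  have hterm : ∀ r, Tendsto (fun i => ∫ ω, tupleCount (m - 1) (k i) 0 r
      (Finset.range m) (counts (C i) (s i) ω) ∂P i) l (𝓝 (a * a ^ r / r !)) := by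
    intro r
    have h := tendsto_integral_tupleCount (w := fun _ => 1)
      (B := fun _ => Finset.range m) hC hn hτ hk
      (hmk.mono fun i hi => (Nat.sub_le _ _).trans hi.le) (fun i => Or.inr rfl)
      (hmk.mono fun i hi => by
        intro b hb
        simp only [Finset.mem_range] at hb ⊢
        omega) (fun _ => zero_le_one)
      (tendsto_tupleMean (w := fun _ => 1) (j := 0) (r := r) (y := a ^ r) hn ha (by
        simpa using hB.pow r))
    simpa using h
  set Λ : ι → ℝ := fun i => n i * poissonWeight (s i / n i) (k i) with hΛ_def
  have hΛ0 : ∀ i, 0 ≤ Λ i := fun i =>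
    mul_nonneg (Nat.cast_nonneg _) (poissonWeight_nonneg (by positivity) _)
  have hmom : ∀ r, Tendsto (fun i => (Λ i)⁻¹ ^ r * ∫ ω, tupleCount (m - 1) (k i) 0 r {k i}
      (counts (C i) (s i) ω) ∂P i) l (𝓝 (a / r !)) := by
    intro r
    have h := tendsto_integral_tupleCount (w := fun i => (Λ i)⁻¹ ^ r)
      (B := fun i => {k i}) hC hn hτ hk
      (hmk.mono fun i hi => (Nat.sub_le _ _).trans hi.le) (fun i => Or.inr rfl)
      (Eventually.of_forall fun i => by simp)
      (fun i => pow_nonneg (inv_nonneg.2 (hΛ0 i)) r)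
      (tendsto_tupleMean (w := fun i => (Λ i)⁻¹ ^ r) (j := 0) (r := r) (y := 1) hn ha (by
        refine tendsto_const_nhds.congr' ?_
        filter_upwards [hq.eventually_gt_atTop 0] with i hi
        rw [pow_zero, one_mul, poissonMass_singleton, ← mul_pow, inv_mul_cancel₀ hi.ne', one_pow]))
    simpa using h
  have hinv : Tendsto (fun i => (Λ i)⁻¹) l (𝓝 0) := hq.inv_tendsto_atTop
  -- The normalized second moment about `Λ` vanishes: its three terms tend to `a`, `-2 a` and `a`.
  have hvar : Tendsto (fun i =>
      2 / Λ i ^ 2 * ∫ ω, tupleCount (m - 1) (k i) 0 2 {k i} (counts (C i) (s i) ω) ∂P i +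
        (1 / Λ i ^ 2 - 2 / Λ i) *
          ∫ ω, tupleCount (m - 1) (k i) 0 1 {k i} (counts (C i) (s i) ω) ∂P i +
        ∫ ω, tupleCount (m - 1) (k i) 0 0 {k i} (counts (C i) (s i) ω) ∂P i) l (𝓝 0) := by
    have h := (((hmom 2).const_mul 2).add ((hinv.sub_const 2).mul (hmom 1))).add (hmom 0)
    have hval : 2 * (a / (2 ! : ℕ)) + (0 - 2) * (a / (1 ! : ℕ)) + a / (0 ! : ℕ) = 0 := by
      simp
      ring
    rw [hval] at h
    refine h.congr fun i => ?_
    ring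
  refine ofReal_le_liminf_of_tendsto (fun i => natCast_mul_measure_eq _ _ _)
    (hG := fun R => ?_)
    (hGu := fun R => (tendsto_finsetSum (Finset.range (2 * R + 2)) fun r _ =>
      (hterm r).const_mul ((-1 : ℝ) ^ r)).sub hvar) ?_
  · filter_upwards [hmk, hq.eventually_gt_atTop 0] with i hi h0
    exact (hC i).le_measureReal_kTons_ne_zero (hn0 i) hm hi h0 (s i) R
  · refine ((tendsto_sum_alternating a).const_mul a).congr fun R => ?_
    rw [Finset.mul_sum, sub_zero]
    refine Finset.sum_congr rfl fun r _ => ?_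
    field_simp

end LocalLimit

/-! ### Measurability of the total and of the number of `k`-tons. -/

section Measurability

lemma measurable_sInf_nat {Ω : Type*} [MeasurableSpace Ω] {A : ℕ → Set Ω}
    (hA : ∀ t, MeasurableSet (A t)) : Measurable fun ω => sInf {t | ω ∈ A t} := by
  refine measurable_to_countable' fun t => ?_
  -- The second set accounts for `sInf ∅ = 0`.
  have h : (fun ω => sInf {t | ω ∈ A t}) ⁻¹' {t} =
      (A t ∩ ⋂ s, ⋂ (_ : s < t), (A s)ᶜ) ∪ ⋂ s, {ω | t = 0 ∧ ω ∈ (A s)ᶜ} := by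
    ext ω
    simp only [Set.mem_preimage, Set.mem_singleton_iff, Set.mem_union, Set.mem_inter_iff,
      Set.mem_iInter, Set.mem_compl_iff]
    constructor
    · intro h
      by_cases hne : {t | ω ∈ A t}.Nonempty
      · left
        subst h
        exact ⟨Nat.sInf_mem hne, fun s hs => Nat.notMem_of_lt_sInf hs⟩
      · right
        rw [Set.not_nonempty_iff_eq_empty] at hne
        rw [hne, Nat.sInf_empty] at h
        exact fun s => ⟨h.symm, fun hs => Set.notMem_empty s (hne ▸ hs)⟩
    · rintro (⟨h1, h2⟩ | h)
      · exact le_antisymm (Nat.sInf_le h1)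
          (le_csInf ⟨t, h1⟩ fun s hs => not_lt.1 fun hst => h2 s hst hs)
      · have : {t | ω ∈ A t} = ∅ := Set.eq_empty_of_forall_notMem fun s hs => (h s).2 hs
        rw [this, Nat.sInf_empty, (h 0).1]
  rw [h]
  refine ((hA t).inter (MeasurableSet.iInter fun s => MeasurableSet.iInter fun _ =>
    (hA s).compl)).union (MeasurableSet.iInter fun s => ?_)
  exact (MeasurableSet.const _).inter (hA s).compl

variable {Ω : Type*} [MeasurableSpace Ω] {P : Measure Ω} {n : ℕ} {C : ℕ → Ω → Fin n}

lemma IsCouponSequence.measurable_total (hC : IsCouponSequence C P) (m : ℕ) :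
    Measurable fun ω => total m fun t => C t ω :=
  measurable_sInf_nat (A := fun t => {ω | ∀ i, m ≤ copies (fun t => C t ω) t i}) fun t =>
    hC.measurableSet_counts t {N | ∀ i, m ≤ N i}

lemma IsCouponSequence.measurable_comp_counts_total (hC : IsCouponSequence C P) (m : ℕ)
    (g : (Fin n → ℕ) → ℕ) : Measurable fun ω => g (counts C (total m fun t => C t ω) ω) := by
  have h : Measurable fun p : ℕ × Ω => g (counts C p.1 p.2) :=
    measurable_from_prod_countable_right fun t =>
      Measurable.of_discrete.comp (hC.measurable_counts t)
  exact h.comp ((hC.measurable_total m).prodMk measurable_id)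

lemma IsCouponSequence.measurable_kTons (hC : IsCouponSequence C P) (m k : ℕ) :
    Measurable fun ω => kTons m k fun t => C t ω := by
  have h := hC.measurable_comp_counts_total m
    fun N => (Finset.univ.filter fun i => N i = k).card
  have heq : (fun ω => kTons m k fun t => C t ω) = fun ω =>
      (Finset.univ.filter fun i => counts C (total m fun t => C t ω) ω i = k).card := by
    ext ω
    simp only [kTons, counts]
    congr
  rw [heq]
  exact h

lemma IsCouponSequence.measurable_normalizedTotal (hC : IsCouponSequence C P) (m : ℕ) :
    Measurable fun ω => normalizedTotal m fun t => C t ω :=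
  (Measurable.of_discrete (f := fun T : ℕ =>
    ((T : ℝ) - n * Real.log n - ((m : ℝ) - 1) * n * Real.log (Real.log n)) / n)).comp
    (hC.measurable_total m)

end Measurability

/-! ### From local bounds to probabilities of events. -/

section Fatou

/-- Rescaling the atoms of an integer valued random variable to a density does not increase the
mass. -/
lemma lintegral_mul_measure_floor_le {Ω : Type*} [MeasurableSpace Ω] (P : Measure Ω) {E : Set Ω}
    (hE : MeasurableSet E) {T : Ω → ℕ} (hT : Measurable T) (a : ℝ) {n : ℕ} (hn : n ≠ 0) :
    ∫⁻ x : ℝ, (n : ℝ≥0∞) * P {ω | ω ∈ E ∧ (T ω : ℤ) = ⌊a + n * x⌋} ≤ P E := by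
  have hn0 : (0 : ℝ) < n := by exact_mod_cast Nat.pos_of_ne_zero hn
  have hfl : Measurable fun x : ℝ => ⌊a + n * x⌋ :=
    Int.measurable_floor.comp (by fun_prop)
  -- Each integer is the floor on an interval of length `1 / n`, which cancels the factor `n`.
  have hvol : ∀ z : ℤ, (Measure.map (fun x : ℝ => ⌊a + n * x⌋) volume) {z} = (n : ℝ≥0∞)⁻¹ := by
    intro z
    rw [Measure.map_apply hfl (measurableSet_singleton z)]
    have : (fun x : ℝ => ⌊a + n * x⌋) ⁻¹' {z} = Set.Ico ((z - a) / n) ((z + 1 - a) / n) := by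
      ext x
      simp only [Set.mem_preimage, Set.mem_singleton_iff, Int.floor_eq_iff, Set.mem_Ico,
        div_le_iff₀ hn0, lt_div_iff₀ hn0]
      constructor <;> rintro ⟨h1, h2⟩ <;> constructor <;> nlinarith
    rw [this, Real.volume_Ico, ← ENNReal.ofReal_natCast, ← ENNReal.ofReal_inv_of_pos hn0]
    congr 1
    field_simp
    ring
  have hT' : ∀ z : ℤ, MeasurableSet {ω | ω ∈ E ∧ (T ω : ℤ) = z} := fun z =>
    hE.inter (hT (MeasurableSet.of_discrete (s := {t : ℕ | (t : ℤ) = z})))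
  calc ∫⁻ x : ℝ, (n : ℝ≥0∞) * P {ω | ω ∈ E ∧ (T ω : ℤ) = ⌊a + n * x⌋}
      = ∫⁻ z : ℤ, (n : ℝ≥0∞) * P {ω | ω ∈ E ∧ (T ω : ℤ) = z}
          ∂(Measure.map (fun x : ℝ => ⌊a + n * x⌋) volume) :=
        (lintegral_map (f := fun z : ℤ => (n : ℝ≥0∞) * P {ω | ω ∈ E ∧ (T ω : ℤ) = z})
          Measurable.of_discrete hfl).symm
    _ = ∑' z : ℤ, P {ω | ω ∈ E ∧ (T ω : ℤ) = z} := by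
        rw [lintegral_countable']
        refine tsum_congr fun z => ?_
        rw [hvol, mul_right_comm, ENNReal.mul_inv_cancel (by exact_mod_cast hn)
          (ENNReal.natCast_ne_top n), one_mul]
    _ = P (⋃ z : ℤ, {ω | ω ∈ E ∧ (T ω : ℤ) = z}) := by
        refine (measure_iUnion (fun z z' hz => ?_) hT').symm
        exact Set.disjoint_left.2 fun ω h1 h2 => hz (h1.2.symm.trans h2.2)
    _ ≤ P E := measure_mono (Set.iUnion_subset fun z ω hω => hω.1)

/-- A local limit bound for an integer valued random variable yields a bound for the probability
of an event. -/
theorem lintegral_le_liminf_measure {ι : Type*} {l : Filter ι} [l.IsCountablyGenerated]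
    {Ω : ι → Type*} [∀ i, MeasurableSpace (Ω i)] (P : ∀ i, Measure (Ω i))
    {E : ∀ i, Set (Ω i)} (hE : ∀ i, MeasurableSet (E i)) {T : ∀ i, Ω i → ℕ}
    (hT : ∀ i, Measurable (T i)) (a : ι → ℝ) {n : ι → ℕ} (hn : ∀ i, n i ≠ 0) {f : ℝ → ℝ≥0∞}
    (hf : ∀ x, f x ≤ liminf (fun i => (n i : ℝ≥0∞) *
      P i {ω | ω ∈ E i ∧ (T i ω : ℤ) = ⌊a i + n i * x⌋}) l) :
    ∫⁻ x, f x ≤ liminf (fun i => P i (E i)) l := by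
  -- Fatou's lemma in the rescaled time `x`.
  refine (lintegral_mono hf).trans ((lintegral_liminf_le fun i => ?_).trans
    (liminf_le_liminf (Eventually.of_forall fun i =>
      lintegral_mul_measure_floor_le (P i) (hE i) (hT i) (a i) (hn i))))
  have hfl : Measurable fun x : ℝ => ⌊a i + n i * x⌋ := Int.measurable_floor.comp (by fun_prop)
  exact (Measurable.of_discrete (f := fun z : ℤ => (n i : ℝ≥0∞) *
    P i {ω | ω ∈ E i ∧ (T i ω : ℤ) = z})).comp hfl

lemma tendsto_measure_compl_of_one_le_liminf {ι : Type*} {l : Filter ι}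
    {Ω : ι → Type*} [∀ i, MeasurableSpace (Ω i)] {P : ∀ i, Measure (Ω i)}
    [∀ i, IsProbabilityMeasure (P i)] {E : ∀ i, Set (Ω i)} (hE : ∀ i, MeasurableSet (E i))
    (h : 1 ≤ liminf (fun i => P i (E i)) l) : Tendsto (fun i => P i (E i)ᶜ) l (𝓝 0) := by
  have h1 : Tendsto (fun i => P i (E i)) l (𝓝 1) := by
    rcases l.eq_or_neBot with rfl | hl
    · exact tendsto_bot
    · exact tendsto_of_le_liminf_of_limsup_le h
        (limsup_le_of_le (by isBoundedDefault) (Eventually.of_forall fun i => prob_le_one))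
  have h2 := ENNReal.Tendsto.sub (tendsto_const_nhds (x := (1 : ℝ≥0∞)) (f := l)) h1
    (Or.inl ENNReal.one_ne_top)
  rw [tsub_self] at h2
  exact h2.congr fun i => (prob_compl_eq_one_sub (hE i)).symm

end Fatou

/-! ### The Gumbel density. -/

section Gumbel

/-- The density of the Gumbel distribution with location `-log c` and scale `1`. -/
lemma gumbel_eq_withDensity {c : ℝ} (hc : 0 < c) :
    gumbel (-Real.log c) 1 one_pos = volume.withDensity fun x =>
      ENNReal.ofReal (Real.exp (-x) / c * Real.exp (-(Real.exp (-x) / c))) := by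
  have hcdf : ∀ x, gumbelCDF (-Real.log c) 1 one_pos x = Real.exp (-(Real.exp (-x) / c)) := by
    intro x
    change Real.exp (-Real.exp (-(x - -Real.log c) / 1)) = _
    rw [div_one, sub_neg_eq_add, neg_add, Real.exp_add, Real.exp_neg (Real.log c),
      Real.exp_log hc, div_eq_mul_inv]
  have hder : ∀ x : ℝ, HasDerivAt (fun x => Real.exp (-(Real.exp (-x) / c)))
      (Real.exp (-x) / c * Real.exp (-(Real.exp (-x) / c))) x := by
    intro x
    have h1 : HasDerivAt (fun x : ℝ => -(Real.exp (-x) / c)) (Real.exp (-x) / c) x := by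
      exact (((hasDerivAt_neg x).exp).div_const c).neg.congr_deriv (by simp [neg_div])
    convert h1.exp using 1
    ring
  unfold gumbel
  have hcont : Continuous fun x : ℝ => Real.exp (-x) / c * Real.exp (-(Real.exp (-x) / c)) := by
    fun_prop
  refine Measure.ext_of_Ioc _ _ fun a b hab => ?_
  rw [StieltjesFunction.measure_Ioc, hcdf, hcdf, withDensity_apply _ measurableSet_Ioc,
    ← ofReal_integral_eq_lintegral_ofReal (hcont.integrableOn_Ioc)
      (Eventually.of_forall fun x => by positivity),
    ← intervalIntegral.integral_of_le hab.le,
    intervalIntegral.integral_eq_sub_of_hasDerivAt (fun x _ => hder x)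
      (hcont.intervalIntegrable _ _)]

lemma lintegral_gumbel_density {c : ℝ} (hc : 0 < c) :
    ∫⁻ x : ℝ, ENNReal.ofReal (Real.exp (-x) / c * Real.exp (-(Real.exp (-x) / c))) = 1 := by
  have h := measure_univ (μ := gumbel (-Real.log c) 1 one_pos)
  rwa [gumbel_eq_withDensity hc, withDensity_apply _ MeasurableSet.univ, setLIntegral_univ] at h

end Gumbel

/-! ### The limit laws at and away from the centring. -/

section Limit

/-- The centring of the total. -/
noncomputable def totalCentre (m n : ℕ) : ℝ :=
  n * Real.log n + ((m : ℝ) - 1) * n * Real.log (Real.log n)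

/-- The number of coupons before the one at the rescaled time `x`. -/
noncomputable def drawIndex (m n : ℕ) (x : ℝ) : ℕ := (⌊totalCentre m n + n * x⌋ - 1).toNat

variable {ι : Type*} {l : Filter ι} {n k : ι → ℕ} {δ : ι → ℝ} {m : ℕ}

/-- The shift by one is that between the completing draw's index and the total. The truncation by
`toNat` is harmless once `log n ≥ 1 - x`, which makes the floor at least `1`. -/
lemma eventually_drawIndex_add_one (hm : 1 ≤ m) (hn : Tendsto n l atTop) (x : ℝ) :
    ∀ᶠ i in l, ((drawIndex m (n i) x + 1 : ℕ) : ℤ) = ⌊totalCentre m (n i) + n i * x⌋ := by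
  have hc : (0 : ℝ) ≤ (m : ℝ) - 1 := by
    have : (1 : ℝ) ≤ m := by exact_mod_cast hm
    linarith
  have hL := tendsto_log_natCast hn
  filter_upwards [hL.eventually_ge_atTop 1, hL.eventually_ge_atTop (1 - x),
    hn.eventually_ge_atTop 1] with i h1 h2 h3
  have h4 : (1 : ℝ) ≤ n i := by exact_mod_cast h3
  have h5 : 0 ≤ Real.log (Real.log (n i)) := Real.log_nonneg h1
  have h6 : (1 : ℝ) ≤ totalCentre m (n i) + n i * x := by
    have : 0 ≤ ((m : ℝ) - 1) * n i * Real.log (Real.log (n i)) := by positivity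
    unfold totalCentre
    nlinarith
  have h7 : 1 ≤ ⌊totalCentre m (n i) + n i * x⌋ := Int.le_floor.2 (by exact_mod_cast h6)
  rw [drawIndex]
  push_cast
  rw [Int.toNat_of_nonneg (by omega)]
  ring

lemma tendsto_floor_sub_div (hn : Tendsto n l atTop) (x : ℝ) :
    Tendsto (fun i => ((⌊totalCentre m (n i) + n i * x⌋ : ℝ) - totalCentre m (n i)) / n i) l
      (𝓝 x) := by
  have hn' : Tendsto (fun i => (n i : ℝ)) l atTop := tendsto_natCast_atTop_atTop.comp hn
  have h1 : Tendsto (fun i => x - 1 / (n i : ℝ)) l (𝓝 x) := by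
    simpa using (tendsto_const_nhds (x := (1 : ℝ))).div_atTop hn' |>.const_sub x
  refine tendsto_of_tendsto_of_tendsto_of_le_of_le' h1 tendsto_const_nhds ?_ ?_
  · filter_upwards [hn'.eventually_gt_atTop 0] with i hi
    rw [le_div_iff₀ hi, sub_mul, one_div_mul_cancel hi.ne']
    linarith [Int.lt_floor_add_one (totalCentre m (n i) + n i * x)]
  · filter_upwards [hn'.eventually_gt_atTop 0] with i hi
    rw [div_le_iff₀ hi]
    linarith [Int.floor_le (totalCentre m (n i) + n i * x)]

lemma tendsto_drawIndex_div (hm : 1 ≤ m) (hn : Tendsto n l atTop) (x : ℝ) :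
    Tendsto (fun i => (drawIndex m (n i) x : ℝ) / n i -
      (Real.log (n i) + (m - 1 : ℕ) * Real.log (Real.log (n i)))) l (𝓝 x) := by
  have hn' : Tendsto (fun i => (n i : ℝ)) l atTop := tendsto_natCast_atTop_atTop.comp hn
  have h1 := (tendsto_floor_sub_div (m := m) hn x).sub
    ((tendsto_const_nhds (x := (1 : ℝ))).div_atTop hn')
  rw [sub_zero] at h1
  refine h1.congr' ?_
  filter_upwards [hn'.eventually_gt_atTop 0, eventually_drawIndex_add_one hm hn x] with i hi h
  have h2 : (⌊totalCentre m (n i) + n i * x⌋ : ℝ) = drawIndex m (n i) x + 1 := by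
    rw [← h]
    push_cast
    rfl
  rw [h2, totalCentre, Nat.cast_sub hm, Nat.cast_one]
  field_simp
  ring

lemma normalizedTotal_eq {n m : ℕ} (c : ℕ → Fin n) :
    normalizedTotal m c = ((total m c : ℝ) - totalCentre m n) / n := by
  rw [normalizedTotal, totalCentre]
  ring

lemma centre_eq (hm : 1 ≤ m) (n : ℕ) :
    centre m n = Real.exp 1 * Real.log n +
      ((Real.exp 1 - 1) * (m - 1 : ℕ) - 1 / 2) * Real.log (Real.log n) := by
  rw [centre, Nat.cast_sub hm, Nat.cast_one]

/-- The limit of the expected number of `k`-tons, up to the factor `exp (-δ)`. -/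
noncomputable def limitMean (x : ℝ) : ℝ :=
  Real.exp ((Real.exp 1 - 1) * x) / √(2 * Real.pi * Real.exp 1)

lemma limitMean_pos (x : ℝ) : 0 < limitMean x := by
  unfold limitMean
  positivity

lemma tendsto_natCast_mul_poissonWeight_mul_exp (hm : 1 ≤ m) (hn : Tendsto n l atTop)
    (hk : ∀ᶠ i in l, (k i : ℝ) = centre m (n i) + δ i)
    (hδ : δ =o[l] fun i => Real.log (Real.log (n i))) (x : ℝ) :
    Tendsto (fun i => n i * poissonWeight (drawIndex m (n i) x / n i) (k i) * Real.exp (δ i)) l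
      (𝓝 (limitMean x)) := by
  simp only [centre_eq hm] at hk
  refine (tendsto_exp_mul_poissonWeight_mul_exp (tendsto_log_natCast hn)
    (tendsto_drawIndex_div hm hn x) hk hδ).congr' ?_
  filter_upwards [eventually_log_pos hn] with i hi
  rw [Real.exp_log hi.2]

lemma tendsto_div_log (hm : 1 ≤ m) (hn : Tendsto n l atTop)
    (hk : ∀ᶠ i in l, (k i : ℝ) = centre m (n i) + δ i)
    (hδ : δ =o[l] fun i => Real.log (Real.log (n i))) :
    Tendsto (fun i => (k i : ℝ) / Real.log (n i)) l (𝓝 (Real.exp 1)) := by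
  simp only [centre_eq hm] at hk
  exact tendsto_div_exp_one (tendsto_log_natCast hn) hk hδ

variable {Ω : ι → Type*} [∀ i, MeasurableSpace (Ω i)] {P : ∀ i, Measure (Ω i)}
  [∀ i, IsProbabilityMeasure (P i)] {C : ∀ i, ℕ → Ω i → Fin (n i)} [l.IsCountablyGenerated]

/-- The number of `k`-tons tends to `0` if `k` lies far above the centring. -/
theorem tendsto_measure_kTons_ne_zero (hm : 1 ≤ m) (hC : ∀ i, IsCouponSequence (C i) (P i))
    (hn : Tendsto n l atTop) (hn0 : ∀ i, n i ≠ 0)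
    (hk : ∀ᶠ i in l, (k i : ℝ) = centre m (n i) + δ i)
    (hδ : δ =o[l] fun i => Real.log (Real.log (n i))) (hδ' : Tendsto δ l atTop) :
    Tendsto (fun i => P i {ω | kTons m (k i) (fun t => C i t ω) = 0}ᶜ) l (𝓝 0) := by
  have hE : ∀ i, MeasurableSet {ω | kTons m (k i) (fun t => C i t ω) = 0} := fun i =>
    (hC i).measurable_kTons m (k i) (measurableSet_singleton 0)
  refine tendsto_measure_compl_of_one_le_liminf hE ?_
  have hpos : (0 : ℝ) < ((m - 1)! : ℕ) := by exact_mod_cast Nat.factorial_pos _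
  rw [← lintegral_gumbel_density hpos]
  refine lintegral_le_liminf_measure P hE (fun i => (hC i).measurable_total m)
    (fun i => totalCentre m (n i)) hn0 fun x => ?_
  have hq : Tendsto (fun i => n i * poissonWeight (drawIndex m (n i) x / n i) (k i)) l (𝓝 0) := by
    have h := (tendsto_natCast_mul_poissonWeight_mul_exp hm hn hk hδ x).mul
      ((Real.tendsto_exp_atBot.comp (tendsto_neg_atTop_atBot.comp hδ')))
    rw [mul_zero] at h
    refine h.congr fun i => ?_
    simp only [Function.comp_apply]
    rw [mul_assoc, ← Real.exp_add, add_neg_cancel, Real.exp_zero, mul_one]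
  -- With `j = 0` and `q = 0` the local bound is the bare Gumbel density, of integral one.
  have h := le_liminf_kTons_eq hm hC hn hn0 (tendsto_drawIndex_div hm hn x)
    (tendsto_div_log hm hn hk hδ) hq 0
  simp only [pow_zero, Nat.factorial_zero, Nat.cast_one, div_one, mul_one, add_zero] at h
  refine h.trans (liminf_le_liminf ?_)
  filter_upwards [eventually_drawIndex_add_one hm hn x] with i hi
  refine mul_le_mul_right (measure_mono ?_) _
  rintro ω ⟨h1, h2⟩
  exact ⟨h2, by rw [h1, hi]⟩

/-- There are `k`-tons with high probability if `k` lies far below the centring. -/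
theorem tendsto_measure_kTons_eq_zero (hm : 1 ≤ m) (hC : ∀ i, IsCouponSequence (C i) (P i))
    (hn : Tendsto n l atTop) (hn0 : ∀ i, n i ≠ 0)
    (hk : ∀ᶠ i in l, (k i : ℝ) = centre m (n i) + δ i)
    (hδ : δ =o[l] fun i => Real.log (Real.log (n i))) (hδ' : Tendsto δ l atBot) :
    Tendsto (fun i => P i {ω | kTons m (k i) (fun t => C i t ω) = 0}) l (𝓝 0) := by
  have hE : ∀ i, MeasurableSet {ω | kTons m (k i) (fun t => C i t ω) ≠ 0} := fun i =>
    (hC i).measurable_kTons m (k i) (MeasurableSet.of_discrete (s := {0}ᶜ))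
  suffices h : Tendsto (fun i => P i {ω | kTons m (k i) (fun t => C i t ω) ≠ 0}ᶜ) l (𝓝 0) by
    refine h.congr fun i => ?_
    congr 1
    ext ω
    simp
  refine tendsto_measure_compl_of_one_le_liminf hE ?_
  have hpos : (0 : ℝ) < ((m - 1)! : ℕ) := by exact_mod_cast Nat.factorial_pos _
  rw [← lintegral_gumbel_density hpos]
  refine lintegral_le_liminf_measure P hE (fun i => (hC i).measurable_total m)
    (fun i => totalCentre m (n i)) hn0 fun x => ?_
  have hq : Tendsto (fun i => n i * poissonWeight (drawIndex m (n i) x / n i) (k i)) l atTop := by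
    have h := (tendsto_natCast_mul_poissonWeight_mul_exp hm hn hk hδ x).pos_mul_atTop
      (limitMean_pos x) (Real.tendsto_exp_atTop.comp (tendsto_neg_atBot_atTop.comp hδ'))
    refine h.congr fun i => ?_
    simp only [Function.comp_apply]
    rw [mul_assoc, ← Real.exp_add, add_neg_cancel, Real.exp_zero, mul_one]
  refine (le_liminf_kTons_ne_zero hm hC hn hn0 (tendsto_drawIndex_div hm hn x)
    (tendsto_div_log hm hn hk hδ) hq).trans (liminf_le_liminf ?_)
  filter_upwards [eventually_drawIndex_add_one hm hn x] with i hi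
  refine mul_le_mul_right (measure_mono ?_) _
  rintro ω ⟨h1, h2⟩
  exact ⟨h2, by rw [h1, hi]⟩

lemma limitLaw_apply (m : ℕ) (d : ℝ) {G : Set (ℝ × ℕ)} (hG : MeasurableSet G) :
    limitLaw m d G = ∫⁻ x, ENNReal.ofReal (Real.exp (-x) / (m - 1)! *
      Real.exp (-(Real.exp (-x) / (m - 1)!))) * poissonMeasure (rate d x) (Prod.mk x ⁻¹' G) := by
  have hpos : (0 : ℝ) < ((m - 1)! : ℕ) := by exact_mod_cast Nat.factorial_pos _
  rw [limitLaw, Measure.compProd_apply hG, gumbel_eq_withDensity hpos,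
    lintegral_withDensity_eq_lintegral_mul₀ (by fun_prop)
      (Kernel.measurable_kernel_prodMk_left hG).aemeasurable]
  rfl

lemma coe_rate (d x : ℝ) : (rate d x : ℝ) = limitMean x * Real.exp (-d) := by
  rw [rate, Real.coe_toNNReal _ (by positivity), limitMean, sub_eq_add_neg, Real.exp_add]
  ring

/-- The joint limit law of the total and the number of `k`-tons. -/
theorem limitLaw_le_liminf (hm : 1 ≤ m) (hC : ∀ i, IsCouponSequence (C i) (P i))
    (hn : Tendsto n l atTop) (hn0 : ∀ i, n i ≠ 0)
    (hk : ∀ᶠ i in l, (k i : ℝ) = centre m (n i) + δ i) {d : ℝ} (hδ : Tendsto δ l (𝓝 d))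
    {G : Set (ℝ × ℕ)} (hG : IsOpen G) :
    limitLaw m d G ≤ liminf (fun i => P i {ω | (normalizedTotal m (fun t => C i t ω),
      kTons m (k i) (fun t => C i t ω)) ∈ G}) l := by
  have hδ' : δ =o[l] fun i => Real.log (Real.log (n i)) := by
    refine (hδ.isBigO_one ℝ).trans_isLittleO ?_
    exact Asymptotics.isLittleO_const_left.2 (Or.inr (tendsto_norm_atTop_atTop.comp
      (Real.tendsto_log_atTop.comp (tendsto_log_natCast hn))))
  rw [limitLaw_apply m d hG.measurableSet]
  have hE : ∀ i, MeasurableSet {ω | (normalizedTotal m (fun t => C i t ω),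
      kTons m (k i) (fun t => C i t ω)) ∈ G} := fun i =>
    (((hC i).measurable_normalizedTotal m).prodMk ((hC i).measurable_kTons m (k i)))
      hG.measurableSet
  refine lintegral_le_liminf_measure P hE (fun i => (hC i).measurable_total m)
    (fun i => totalCentre m (n i)) hn0 fun x => ?_
  have hq : Tendsto (fun i => n i * poissonWeight (drawIndex m (n i) x / n i) (k i)) l
      (𝓝 (rate d x)) := by
    rw [coe_rate]
    refine ((tendsto_natCast_mul_poissonWeight_mul_exp hm hn hk hδ' x).mul
      ((Real.continuous_exp.tendsto _).comp hδ.neg)).congr fun i => ?_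
    simp only [Function.comp_apply]
    rw [mul_assoc, ← Real.exp_add, add_neg_cancel, Real.exp_zero, mul_one]
  let K : ι → ℕ → ℝ≥0∞ := fun i j => (n i : ℝ≥0∞) *
    P i {ω | ((normalizedTotal m (fun t => C i t ω), kTons m (k i) (fun t => C i t ω)) ∈ G ∧
      (total m (fun t => C i t ω) : ℤ) = ⌊totalCentre m (n i) + n i * x⌋) ∧
      kTons m (k i) (fun t => C i t ω) = j}
  have hloc : ∀ j, (x, j) ∈ G → ENNReal.ofReal (Real.exp (-x) / (m - 1)! *
      Real.exp (-(Real.exp (-x) / (m - 1)!))) * poissonMeasure (rate d x) {j} ≤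
      liminf (fun i => K i j) l := by
    intro j hj
    have h := le_liminf_kTons_eq hm hC hn hn0 (tendsto_drawIndex_div hm hn x)
      (tendsto_div_log hm hn hk hδ') hq j
    rw [poissonMeasure_singleton, ← ENNReal.ofReal_mul (by positivity)]
    refine le_trans (le_of_eq ?_) (h.trans (liminf_le_liminf ?_))
    · rw [neg_add, Real.exp_add]
      congr 1
      ring
    -- The lattice points approximating `x` converge to it, so by openness they end up in `G` at
    -- level `j`.
    have hopen : ∀ᶠ i in l,
        (((⌊totalCentre m (n i) + n i * x⌋ : ℝ) - totalCentre m (n i)) / n i, j) ∈ G :=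
      ((tendsto_floor_sub_div hn x).prodMk_nhds tendsto_const_nhds).eventually
        (hG.mem_nhds hj)
    filter_upwards [eventually_drawIndex_add_one hm hn x, hopen] with i h1 h2
    refine mul_le_mul_right (measure_mono ?_) _
    rintro ω ⟨h3, h4⟩
    refine ⟨⟨?_, by rw [h3, h1]⟩, h4⟩
    rw [normalizedTotal_eq, h3, h4]
    rw [← h1] at h2
    exact_mod_cast h2
  calc _ = ∑' j, (Prod.mk x ⁻¹' G).indicator (fun j => ENNReal.ofReal (Real.exp (-x) / (m - 1)! *
      Real.exp (-(Real.exp (-x) / (m - 1)!))) * poissonMeasure (rate d x) {j}) j := by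
        rw [← lintegral_indicator_one (MeasurableSet.of_discrete (s := Prod.mk x ⁻¹' G)),
          lintegral_countable', ← ENNReal.tsum_mul_left]
        refine tsum_congr fun j => ?_
        by_cases hj : j ∈ Prod.mk x ⁻¹' G <;> simp [hj]
    _ ≤ ∑' j, liminf (fun i => K i j) l := by
        exact ENNReal.tsum_le_tsum fun j =>
          Set.indicator_apply_le' (fun hj => hloc j hj) fun _ => zero_le
    _ ≤ liminf (fun i => ∑' j, K i j) l := by
        -- Fatou's lemma once more, for counting measure, exchanges the sum over `j` with the
        -- `liminf`.
        simp only [← lintegral_count]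
        exact lintegral_liminf_le fun i => Measurable.of_discrete
    _ ≤ _ := by
        refine liminf_le_liminf (Eventually.of_forall fun i => ?_)
        simp only [K]
        rw [ENNReal.tsum_mul_left]
        gcongr
        rw [← measure_iUnion]
        · exact measure_mono (Set.iUnion_subset fun j ω hω => hω.1)
        · intro j j' hj
          exact Set.disjoint_left.2 fun ω h1 h2 => hj (h1.2.symm.trans h2.2)
        · intro j
          exact ((hE i).inter ((hC i).measurable_total m (MeasurableSet.of_discrete
            (s := {t : ℕ | (t : ℤ) = ⌊totalCentre m (n i) + n i * x⌋})))).inter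
            ((hC i).measurable_kTons m (k i) (measurableSet_singleton j))

end Limit

end CouponCollector

/-! ### The three regimes. -/

theorem theorem2 (m : ℕ) (hm : 1 ≤ m)
    {Ω : ℕ+ → Type*} [∀ n, MeasurableSpace (Ω n)]
    (P : ∀ n, Measure (Ω n)) [∀ n, IsProbabilityMeasure (P n)]
    (C : ∀ n : ℕ+, ℕ → Ω n → Fin n) (hC : ∀ n, IsCouponSequence (C n) (P n)) :
    -- first part: `k_j` is the centring plus `δ_j`, with `δ_j → d`
    (∀ (d : ℝ) (n : ℕ → ℕ+) (δ : ℕ → ℝ) (k : ℕ → ℕ),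
      StrictMono n → Tendsto δ atTop (𝓝 d) →
      (∀ j, 2 ≤ n j → (k j : ℝ) = centre m (n j) + δ j) →
      TendstoInDistribution
        (fun j (ω : Ω (n j)) =>
          (normalizedTotal m (fun t => C (n j) t ω), kTons m (k j) (fun t => C (n j) t ω)))
        atTop (id : ℝ × ℕ → ℝ × ℕ) (fun j => P (n j)) (limitLaw m d)) ∧
    -- second part: the offset is `g(n)`
    (∀ (g : ℕ+ → ℝ) (k : ℕ+ → ℕ),
      g =o[atTop] (fun n : ℕ+ => Real.log (Real.log n)) → Tendsto g atTop atTop →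
      (∀ n : ℕ+, 2 ≤ n → (k n : ℝ) = centre m n + g n) →
      ∀ ε : ℝ, 0 < ε →
        Tendsto (fun n : ℕ+ => P n {ω | ε ≤ |(kTons m (k n) (fun t => C n t ω) : ℝ) - 0|})
          atTop (𝓝 0)) ∧
    -- third part: the offset is `-g(n)`
    (∀ (g : ℕ+ → ℝ) (k : ℕ+ → ℕ),
      g =o[atTop] (fun n : ℕ+ => Real.log (Real.log n)) → Tendsto g atTop atTop →
      (∀ n : ℕ+, 2 ≤ n → (k n : ℝ) = centre m n - g n) →
      Tendsto (fun n : ℕ+ => P n {ω | kTons m (k n) (fun t => C n t ω) = 0}) atTop (𝓝 0)) := by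

  have hcoe : Tendsto (fun n : ℕ+ => (n : ℕ)) atTop atTop :=
    tendsto_atTop_atTop.2 fun b => ⟨b.succPNat, fun a ha =>
      (Nat.le_succ b).trans (by exact_mod_cast ha)⟩
  have htwo : ∀ᶠ n : ℕ+ in atTop, 2 ≤ n := eventually_ge_atTop 2
  refine ⟨fun d n δ k hn hδ hk => ?_, fun g k hg hg' hk ε hε => ?_, fun g k hg hg' hk => ?_⟩
  · have hmeas : ∀ j, Measurable fun ω => (normalizedTotal m (fun t => C (n j) t ω),
        kTons m (k j) (fun t => C (n j) t ω)) := fun j =>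
      ((hC (n j)).measurable_normalizedTotal m).prodMk ((hC (n j)).measurable_kTons m (k j))
    refine ⟨fun j => (hmeas j).aemeasurable, aemeasurable_id, ?_⟩
    -- Portmanteau theorem: lower bounds on open sets suffice.
    refine tendsto_of_forall_isOpen_le_liminf_nat' fun G hG => ?_
    have h := limitLaw_le_liminf hm (fun j => hC (n j)) hn.tendsto_atTop
      (fun j => (n j).ne_zero)
      ((hn.tendsto_atTop.eventually_ge_atTop 2).mono fun j hj => hk j (by exact_mod_cast hj)) hδ hG
    simp only [ProbabilityMeasure.coe_mk, Measure.map_id]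
    refine h.trans_eq (congrArg (fun f => liminf f atTop) (funext fun j => ?_))
    rw [Measure.map_apply (hmeas j) hG.measurableSet]
    rfl
  · have h := tendsto_measure_kTons_ne_zero hm hC hcoe (fun n => n.ne_zero)
      (htwo.mono fun n hn => hk n hn) hg hg'
    -- A deviation of at least `ε > 0` from `0` forces a nonzero number of `k`-tons.
    refine tendsto_of_tendsto_of_tendsto_of_le_of_le tendsto_const_nhds h
      (fun n => zero_le) fun n => measure_mono fun ω hω h0 => ?_
    have h0' : kTons m (k n) (fun t => C n t ω) = 0 := h0
    have hω' : ε ≤ |(kTons m (k n) (fun t => C n t ω) : ℝ) - 0| := hω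
    rw [h0', Nat.cast_zero, sub_zero, abs_zero] at hω'
    exact absurd hω' (not_le.2 hε)
  · exact tendsto_measure_kTons_eq_zero hm hC hcoe (fun n => n.ne_zero)
      (htwo.mono fun n hn => (hk n hn).trans (sub_eq_add_neg _ _)) hg.neg_left
      (tendsto_neg_atTop_atBot.comp hg')
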